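/- Let $0<p<1$. In the Bernoulli model, the random series-parallel network of size $1$ is a single directed edge, labelled $1$, from the source to the sink. For $n\ge 2$, the network of size $n$ arises from the network of size $n-1$ by choosing one of its $n-1$ edges uniformly at random, say edge $j=(x,y)$, and then, independently, either with probability $p$ doubling it in a parallel way (a further edge $(x,y)$, labelled $n$, is inserted) or with probability $1-p$ doubling it in a serial way (edge $j$ is replaced by $(x,z)$, labelled $j$, and $(z,y)$, labelled $n$, with $z$ a new node). Let $L_n$ be the length (number of edges) of a random path from the source to the sink in the random network of size $n$, where the path starts at the source and, at each node reached before the sink, follows one of its outgoing edges chosen uniformly at random. Then $$\mathbb{P}\{L_n=m\}=\sum_{j=0}^{m-1}\binom{m-1}{j}(-1)^{n+j-1}\binom{j-p(j+1)}{n-1},\qquad 1\le m\le n,$$ where $\binom{a}{k}=a(a-1)\cdots(a-k+1)/k!$ for real $a$. Moreover, as $n\to\infty$, $L_n/n^{1-p}$ converges in distribution to a random variable $L$ having the Mittag-Leffler distribution with parameter $1-p$: its distribution is the unique probability distribution on $\mathbb{R}$ with the integer moments $$\mathbb{E}(L^r)=\frac{r!}{\Gamma(r(1-p)+1)},\qquad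 r\ge 0,$$ and it is concentrated on $(0,\infty)$ with the density function $$g(x)=\frac{1}{2\pi i}\int_{\mathcal H}\frac{e^{-t-x(-t)^{1-p}}}{(-t)^{p}}\,dt,\qquad x>0,$$ where the powers are principal branches and $\mathcal H$ is any Hankel contour consisting, for some $\delta>0$, of the ray from $+\infty-i\delta$ to $-i\delta$, the half circle of radius $\delta$ from $-i\delta$ through $-\delta$ to $i\delta$, and the ray from $i\delta$ to $+\infty+i\delta$; the integral converges absolutely and does not depend on $\delta$. -/

import Mathlib

open MeasureTheory Filter Set

/-- A directed multigraph with `n` edges, labelled by `Fin n` (the edge with label `j` of a network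
is the edge of index `j - 1`), on the nodes `0, ..., order - 1`; `edge e` is the pair
(tail, head) of the edge `e`. Node `0` is the source and node `1` is the sink. -/
structure Network (n : ℕ) where
  order : ℕ
  edge : Fin n → ℕ × ℕ

namespace Network

def source : ℕ := 0

def sink : ℕ := 1

/-- The network of size `1`: a single edge from the source to the sink. -/
def single : Network 1 where
  order := 2
  edge := fun _ => (source, sink)

variable {n : ℕ}

/-- Parallel doubling of the edge `j = (x, y)`: a further edge `(x, y)`, carrying the new label,
is added. -/
def parallel (G : Network n) (j : Fin n) : Network (n + 1) where
  order := G.order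
  edge := Fin.snoc (α := fun _ => ℕ × ℕ) G.edge (G.edge j)

/-- Serial doubling of the edge `j = (x, y)`: it is replaced by `(x, z)` and `(z, y)`, where `z` is
a new node, `(x, z)` keeps the label `j` and `(z, y)` carries the new label. -/
def serial (G : Network n) (j : Fin n) : Network (n + 1) where
  order := G.order + 1
  edge := Fin.snoc (α := fun _ => ℕ × ℕ)
    (Function.update G.edge j ((G.edge j).1, G.order)) (G.order, (G.edge j).2)

/-- The edges going out of the node `x`. -/
def outEdges (G : Network n) (x : ℕ) : Finset (Fin n) :=
  Finset.univ.filter fun e => (G.edge e).1 = x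

open Classical in
/-- The random walk along outgoing edges from the node `x` to the sink, as the list of the edges
traversed: at every node other than the sink one of the outgoing edges is chosen uniformly at
random. The first argument bounds the number of steps. -/
noncomputable def randomWalk (G : Network n) : ℕ → ℕ → PMF (List (Fin n))
  | 0, _ => PMF.pure []
  | k + 1, x =>
    if h : x ≠ sink ∧ (G.outEdges x).Nonempty then
      (PMF.uniformOfFinset (G.outEdges x) h.2).bind fun e =>
        (G.randomWalk k (G.edge e).2).map fun l => e :: l
    else PMF.pure []

/-- A random source-to-sink path. Series-parallel networks are acyclic, so that a directed path
uses every edge at most once and the bound of `n` steps is no restriction. -/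
noncomputable def randomPath (G : Network n) : PMF (List (Fin n)) :=
  G.randomWalk n source

end Network

/-- A coin showing `true` with probability `p` and `false` with probability `1 - p`. -/
noncomputable def coin (p : ℝ) (hp : p ∈ Ioo (0 : ℝ) 1) : PMF Bool :=
  PMF.ofFintype (fun b => ENNReal.ofReal (if b then p else 1 - p)) (by
    have h : (0 : ℝ) ≤ 1 - p := by linarith [hp.2]
    simp [← ENNReal.ofReal_add hp.1.le h])

/-- The Bernoulli model: the law of the random network of size `n + 1`, that is after `n`
doublings. In each step a uniformly random edge is doubled, independently in a parallel way with
probability `p` and in a serial way with probability `1 - p`. -/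
noncomputable def bernoulliNetwork (p : ℝ) (hp : p ∈ Ioo (0 : ℝ) 1) : (n : ℕ) → PMF (Network (n + 1))
  | 0 => PMF.pure Network.single
  | n + 1 =>
    (bernoulliNetwork p hp n).bind fun G =>
      (PMF.uniformOfFintype (Fin (n + 1))).bind fun j =>
        (coin p hp).map fun b => if b then G.parallel j else G.serial j

/-- The law of the length `L_n` (number of edges) of a random source-to-sink path in the random
network of size `n`, for `n ≥ 1`; there is no network of size `0` and the value there is a mere
convention. -/
noncomputable def pathLength (p : ℝ) (hp : p ∈ Ioo (0 : ℝ) 1) : ℕ → PMF ℕ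
  | 0 => PMF.pure 0
  | n + 1 => (bernoulliNetwork p hp n).bind fun G => G.randomPath.map List.length

/-- The Mittag-Leffler distribution with parameter `α`: all moments are finite and the `r`-th
moment is `r! / Γ(r α + 1)`. -/
def IsMittagLeffler (α : ℝ) (μ : ProbabilityMeasure ℝ) : Prop :=
  ∀ r : ℕ, Integrable (fun x : ℝ => x ^ r) (μ : Measure ℝ) ∧
    ∫ x, x ^ r ∂(μ : Measure ℝ) = (r.factorial : ℝ) / Real.Gamma (r * α + 1)

/-- The lower and the upper ray and the arc of the Hankel contour of width `δ`. The lower ray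
is parametrized by its distance to `-iδ`, the arc is the left half of the circle of radius `δ`
about `0`, parametrized clockwise from `-iδ` through `-δ` to `iδ`. -/
noncomputable def hankelLower (δ u : ℝ) : ℂ := u - δ * Complex.I

noncomputable def hankelUpper (δ u : ℝ) : ℂ := u + δ * Complex.I

noncomputable def hankelArc (δ θ : ℝ) : ℂ := -(δ * Complex.I) * Complex.exp (-(θ * Complex.I))

/-- The integral of `f` along the Hankel contour of width `δ` is absolutely convergent. -/
def HankelIntegrable (δ : ℝ) (f : ℂ → ℂ) : Prop :=
  IntegrableOn (fun u : ℝ => f (hankelLower δ u)) (Ioi 0) ∧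
  IntervalIntegrable (fun θ : ℝ => f (hankelArc δ θ) * deriv (hankelArc δ) θ) volume 0 Real.pi ∧
  IntegrableOn (fun u : ℝ => f (hankelUpper δ u)) (Ioi 0)

/-- The integral of `f` along the Hankel contour of width `δ`, which comes from `+∞` below the
positive real axis, passes around `0` and returns to `+∞` above the positive real axis. -/
noncomputable def hankelIntegral (δ : ℝ) (f : ℂ → ℂ) : ℂ :=
  -(∫ u in Ioi (0 : ℝ), f (hankelLower δ u)) +
    (∫ θ in (0 : ℝ)..Real.pi, f (hankelArc δ θ) * deriv (hankelArc δ) θ) +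
    ∫ u in Ioi (0 : ℝ), f (hankelUpper δ u)

/-- The integrand `e^{-t - x (-t)^{1-p}} / (-t)^p`, with principal branches, which are analytic off
the non-negative real axis. -/
noncomputable def densityIntegrand (p x : ℝ) (t : ℂ) : ℂ :=
  Complex.exp (-t - x * (-t) ^ ((1 - p : ℝ) : ℂ)) / (-t) ^ (p : ℂ)

/-! For a fixed network of size n let u be the generating polynomial of the length of its random
path. Doubling a uniformly random edge in a parallel way leaves u unchanged on average. Serial
doubling adds (X² - X)u'/n, because it lengthens the path exactly when it hits one of its edges.
Hence the laws of the lengths satisfy a closed linear recursion in which the networks no longer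
occur (`pathLength_add_two`). The sequences m ↦ C(m-1, j) are eigenvectors of this recursion with
eigenvalues 1 - (1-p)(j+1)/n, and expanding the initial point mass in them gives the explicit
formula. The rising factorials m(m+1)⋯(m+r-1) are eigenfunctions of the adjoint with eigenvalues 1 +
(1-p)r/n, so Euler's limit for Γ yields the limits r!/Γ(r(1-p)+1) of the rescaled moments.

For the density put α = 1 - p. In the coordinate w = log(-t) the Hankel integrand becomes the entire
function exp(e^w - x e^{αw} + αw). Its integral is defined as the difference of the limits of a
primitive at the ends of two horizontal strips, so that it does not depend on the path. Along rays
at height ±π/(1+α), e^w has negative and e^{αw} positive real part. Hence g is a combination of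
mixtures of exponentials decaying in x. Moving the contour to the right shows that g decays faster
than every exponential, and Fubini turns its moments into Hankel's integrals for 1/Γ.

Such decay makes Taylor expansion of characteristic functions effective: convergence of moments
implies convergence of characteristic functions to the Fourier transform of g, whatever the sign of
g (`SuperexpDecay.method_of_moments`). Tightness provides a limit law, and comparing it with g dx
forces g ≥ 0. Applied to a constant sequence, the argument gives uniqueness of the law with these
moments. -/

namespace Network

/-! ### Generating functions of path lengths on a fixed network -/

variable {n : ℕ}

open Polynomial in
/-- The generating function of the length of the random walk of at most `k` steps from `x`. -/
noncomputable def pathPoly (G : Network n) : ℕ → ℕ → ℝ[X]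
  | 0, _ => 1
  | k + 1, x =>
    if x ≠ sink ∧ (G.outEdges x).Nonempty then
      C ((G.outEdges x).card : ℝ)⁻¹ * ∑ e ∈ G.outEdges x, X * G.pathPoly k (G.edge e).2
    else 1

theorem map_cons_map_length (μ : PMF (List (Fin n))) (e : Fin n) :
    (μ.map (fun l => e :: l)).map List.length = (μ.map List.length).map Nat.succ := by
  rw [PMF.map_comp, PMF.map_comp]; rfl

theorem map_succ_apply_succ (μ : PMF ℕ) (m : ℕ) : μ.map Nat.succ (m + 1) = μ m := by
  rw [PMF.map_apply, tsum_eq_single m]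
  · simp
  · intro b hb
    simp [hb.symm]

/-- Replaces probabilities by coefficients, so that the effect of a doubling becomes algebra in
`ℝ[X]`. -/
theorem toReal_randomWalk_length (G : Network n) (k x m : ℕ) :
    ((G.randomWalk k x).map List.length m).toReal = (G.pathPoly k x).coeff m := by
  induction k generalizing x m with
  | zero =>
    simp only [randomWalk, pathPoly, PMF.pure_map, PMF.pure_apply, List.length_nil,
      Polynomial.coeff_one]
    split_ifs <;> simp
  | succ k ih =>
    by_cases h : x ≠ sink ∧ (G.outEdges x).Nonempty
    · simp only [randomWalk, dif_pos h, pathPoly, if_pos h]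
      rw [PMF.map_bind, PMF.bind_apply, tsum_fintype, Polynomial.coeff_C_mul,
        Polynomial.finsetSum_coeff, Finset.mul_sum, ENNReal.toReal_sum]
      · rw [← Finset.sum_subset (Finset.subset_univ (G.outEdges x))]
        · refine Finset.sum_congr rfl fun e he => ?_
          rw [PMF.uniformOfFinset_apply_of_mem _ he, map_cons_map_length, ENNReal.toReal_mul]
          congr 1
          · simp
          · cases m with
            | zero => simp
            | succ m => rw [map_succ_apply_succ, ih, Polynomial.coeff_X_mul]
        · intro e _ he
          rw [PMF.uniformOfFinset_apply_of_notMem _ he]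
          simp
      · intro e _
        exact ENNReal.mul_ne_top (PMF.apply_ne_top _ _) (PMF.apply_ne_top _ _)
    · simp only [randomWalk, dif_neg h, pathPoly, if_neg h, PMF.pure_map, PMF.pure_apply,
        List.length_nil, Polynomial.coeff_one]
      split_ifs <;> simp

/-- The walk is cut off after `k` steps, so lengths beyond the number of edges are excluded without
any appeal to acyclicity. -/
theorem natDegree_pathPoly_le (G : Network n) (k x : ℕ) : (G.pathPoly k x).natDegree ≤ k := by
  induction k generalizing x with
  | zero => simp [pathPoly]
  | succ k ih =>
    rw [pathPoly]
    split_ifs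
    · refine (Polynomial.natDegree_C_mul_le _ _).trans
        (Polynomial.natDegree_sum_le_of_forall_le _ _ fun e _ => ?_)
      refine Polynomial.natDegree_mul_le.trans ?_
      rw [Polynomial.natDegree_X, add_comm]
      exact Nat.add_le_add_right (ih _) 1
    · simp

@[simp]
theorem parallel_edge_last (G : Network n) (j : Fin n) :
    (G.parallel j).edge (Fin.last n) = G.edge j := by
  simp [parallel]

@[simp]
theorem parallel_edge_castSucc (G : Network n) (j e : Fin n) :
    (G.parallel j).edge e.castSucc = G.edge e := by
  simp [parallel]

@[simp]
theorem serial_edge_last (G : Network n) (j : Fin n) :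
    (G.serial j).edge (Fin.last n) = (G.order, (G.edge j).2) :=
  Fin.snoc_last (α := fun _ => ℕ × ℕ) _ _

@[simp]
theorem serial_edge_castSucc (G : Network n) (j e : Fin n) :
    (G.serial j).edge e.castSucc = ((G.edge e).1, if e = j then G.order else (G.edge e).2) := by
  refine (Fin.snoc_castSucc (α := fun _ => ℕ × ℕ) _ _ _).trans ?_
  by_cases h : e = j
  · subst h; simp
  · simp [h]

/-- A height function on the nodes of a network, strictly decreasing along the edges. -/
structure Layered (G : Network n) (h : ℕ → ℕ) : Prop where
  lt : ∀ e, h (G.edge e).2 < h (G.edge e).1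
  le : ∀ x, h x ≤ n
  two_le : 2 ≤ G.order
  tail_lt : ∀ e, (G.edge e).1 < G.order
  head_lt : ∀ e, (G.edge e).2 < G.order

theorem single_layered : single.Layered (fun x => if x = 0 then 1 else 0) where
  lt := by intro e; simp [single, source, sink]
  le := by intro x; split_ifs <;> simp
  two_le := le_rfl
  tail_lt := by intro e; simp [single, source]
  head_lt := by intro e; simp [single, sink]

theorem Layered.parallel {G : Network n} {h : ℕ → ℕ} (hG : G.Layered h) (j : Fin n) :
    (G.parallel j).Layered h where
  lt := by
    intro e
    induction e using Fin.lastCases with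
    | last => simpa using hG.lt j
    | cast e => simpa using hG.lt e
  le := fun x => (hG.le x).trans n.le_succ
  two_le := hG.two_le
  tail_lt := by
    intro e
    change _ < G.order
    induction e using Fin.lastCases with
    | last => simpa using hG.tail_lt j
    | cast e => simpa using hG.tail_lt e
  head_lt := by
    intro e
    change _ < G.order
    induction e using Fin.lastCases with
    | last => simpa using hG.head_lt j
    | cast e => simpa using hG.head_lt e

/-- Every node above the head y of `j` is lifted by one, which makes room for the new node just
above y and below the lifted tail. -/
theorem Layered.serial {G : Network n} {h : ℕ → ℕ} (hG : G.Layered h) (j : Fin n) :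
    (G.serial j).Layered (fun v => if v = G.order then h (G.edge j).2 + 1 else
      if h (G.edge j).2 < h v then h v + 1 else h v) where
  lt := by
    intro e
    have hj := hG.lt j
    have hj1 := hG.tail_lt j
    have hj2 := hG.head_lt j
    induction e using Fin.lastCases with
    | last => simp [hj2.ne]
    | cast e =>
      have he := hG.lt e
      have he1 := hG.tail_lt e
      have he2 := hG.head_lt e
      by_cases hej : e = j
      · subst hej
        simp [hj1.ne, hj]
      · simp only [serial_edge_castSucc, he1.ne, he2.ne, if_false, hej]
        split_ifs <;> omega
  le := by
    intro x
    have := hG.le x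
    have := hG.le (G.edge j).1
    have := hG.lt j
    split_ifs <;> omega
  two_le := hG.two_le.trans (Nat.le_succ _)
  tail_lt := by
    intro e
    change _ < G.order + 1
    induction e using Fin.lastCases with
    | last => simp
    | cast e => simpa using (hG.tail_lt e).le
  head_lt := by
    intro e
    change _ < G.order + 1
    induction e using Fin.lastCases with
    | last => simpa using (hG.head_lt j).le
    | cast e =>
      have he1 := hG.head_lt e
      rw [serial_edge_castSucc]
      dsimp only
      split_ifs <;> omega

theorem mem_outEdges {G : Network n} {x : ℕ} {e : Fin n} :
    e ∈ G.outEdges x ↔ (G.edge e).1 = x := by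
  simp [outEdges]

theorem sum_outEdges_parallel {M : Type*} [AddCommMonoid M] (G : Network n) (j : Fin n) (x : ℕ)
    (f : Fin (n + 1) → M) :
    ∑ e ∈ (G.parallel j).outEdges x, f e =
      ∑ e ∈ G.outEdges x, f e.castSucc + if j ∈ G.outEdges x then f (Fin.last n) else 0 := by
  simp [outEdges, Finset.sum_filter, Fin.sum_univ_castSucc]

theorem sum_outEdges_serial {M : Type*} [AddCommMonoid M] (G : Network n) (j : Fin n) {x : ℕ}
    (hx : x < G.order) (f : Fin (n + 1) → M) :
    ∑ e ∈ (G.serial j).outEdges x, f e = ∑ e ∈ G.outEdges x, f e.castSucc := by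
  simp [outEdges, Finset.sum_filter, Fin.sum_univ_castSucc, hx.ne']

theorem card_outEdges_parallel (G : Network n) (j : Fin n) (x : ℕ) :
    ((G.parallel j).outEdges x).card =
      (G.outEdges x).card + if j ∈ G.outEdges x then 1 else 0 := by
  simp only [Finset.card_eq_sum_ones, sum_outEdges_parallel]

theorem card_outEdges_serial (G : Network n) (j : Fin n) {x : ℕ} (hx : x < G.order) :
    ((G.serial j).outEdges x).card = (G.outEdges x).card := by
  simp only [Finset.card_eq_sum_ones, sum_outEdges_serial G j hx]

theorem outEdges_parallel_eq_empty {G : Network n} {j : Fin n} {x : ℕ} :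
    (G.parallel j).outEdges x = ∅ ↔ G.outEdges x = ∅ := by
  rw [← Finset.card_eq_zero, ← Finset.card_eq_zero, card_outEdges_parallel]
  constructor
  · intro h; omega
  · intro h
    rw [Finset.card_eq_zero] at h
    simp [h]

theorem outEdges_serial_eq_empty {G : Network n} {j : Fin n} {x : ℕ} (hx : x < G.order) :
    (G.serial j).outEdges x = ∅ ↔ G.outEdges x = ∅ := by
  rw [← Finset.card_eq_zero, ← Finset.card_eq_zero, card_outEdges_serial G j hx]

theorem outEdges_serial_order {G : Network n} {h : ℕ → ℕ} (hG : G.Layered h) (j : Fin n) :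
    (G.serial j).outEdges G.order = {Fin.last n} := by
  ext e
  rw [mem_outEdges, Finset.mem_singleton]
  induction e using Fin.lastCases with
  | last => simp
  | cast e => simp [(hG.tail_lt e).ne, Fin.castSucc_ne_last]

open Polynomial in
/-- The recursion that determines the generating functions of the path lengths. -/
structure IsPathGF (G : Network n) (u : ℕ → ℝ[X]) : Prop where
  terminal : ∀ x, x = sink ∨ G.outEdges x = ∅ → u x = 1
  step : ∀ x, x ≠ sink → G.outEdges x ≠ ∅ →
    ((G.outEdges x).card : ℝ[X]) * u x = X * ∑ e ∈ G.outEdges x, u (G.edge e).2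

/-- Heights drop along the walk, so from `x` it takes at most `h x` steps and a larger step budget
is never used. -/
theorem pathPoly_succ_eq {G : Network n} {h : ℕ → ℕ} (hG : G.Layered h) (k x : ℕ) (hx : h x ≤ k) :
    G.pathPoly (k + 1) x = G.pathPoly k x := by
  induction k generalizing x with
  | zero =>
    have h0 : ¬(x ≠ sink ∧ (G.outEdges x).Nonempty) := by
      rintro ⟨-, e, he⟩
      have h1 := hG.lt e
      rw [mem_outEdges.1 he] at h1
      omega
    simp [pathPoly, h0]
  | succ k ih =>
    rw [pathPoly, pathPoly]
    congr 2
    refine Finset.sum_congr rfl fun e he => ?_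
    rw [ih]
    have h1 := hG.lt e
    rw [mem_outEdges.1 he] at h1
    omega

/-- The budget `n` bounds all heights and may be raised by one for free; this removes the step
counter from the recursion. -/
theorem Layered.isPathGF {G : Network n} {h : ℕ → ℕ} (hG : G.Layered h) :
    G.IsPathGF (G.pathPoly n) where
  terminal := by
    intro x hx
    rw [← pathPoly_succ_eq hG n x (hG.le x), pathPoly, if_neg]
    rintro ⟨h1, h2⟩
    rcases hx with h3 | h3
    · exact h1 h3
    · exact h2.ne_empty h3
  step := by
    intro x hx hne
    have hc : ((G.outEdges x).card : ℝ) ≠ 0 := by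
      rw [Nat.cast_ne_zero]
      exact Finset.card_ne_zero.2 (Finset.nonempty_iff_ne_empty.2 hne)
    rw [← pathPoly_succ_eq hG n x (hG.le x), pathPoly,
      if_pos ⟨hx, Finset.nonempty_iff_ne_empty.2 hne⟩, ← mul_assoc, ← Polynomial.C_eq_natCast,
      ← Polynomial.C_mul, mul_inv_cancel₀ hc, Polynomial.C_1, one_mul, ← Finset.mul_sum]

open Polynomial

theorem natCast_card_ne_zero {s : Finset (Fin n)} (hs : s ≠ ∅) : (s.card : ℝ[X]) ≠ 0 :=
  Nat.cast_ne_zero.2 (Finset.card_ne_zero.2 (Finset.nonempty_iff_ne_empty.2 hs))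

/-- A walk that starts below the tail of `j` never reaches that tail and so does not see the
doubling. -/
theorem pathGF_parallel_of_lt {G : Network n} {h : ℕ → ℕ} (hG : G.Layered h) {u v : ℕ → ℝ[X]}
    (hu : G.IsPathGF u) (j : Fin n) (hv : (G.parallel j).IsPathGF v) (x : ℕ)
    (hx : h x < h (G.edge j).1) : v x = u x := by
  induction hk : h x using Nat.strong_induction_on generalizing x with
  | _ k ih =>
    by_cases hs : x = sink ∨ G.outEdges x = ∅
    · rw [hu.terminal x hs, hv.terminal x (by rwa [outEdges_parallel_eq_empty])]
    · rw [not_or] at hs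
      have h1 := hu.step x hs.1 hs.2
      have h2 := hv.step x hs.1 (by rw [Ne, outEdges_parallel_eq_empty]; exact hs.2)
      have hj : j ∉ G.outEdges x := fun hj => by
        rw [mem_outEdges.1 hj] at hx
        exact lt_irrefl _ hx
      rw [card_outEdges_parallel, sum_outEdges_parallel, if_neg hj, if_neg hj, add_zero,
        add_zero] at h2
      refine mul_left_cancel₀ (natCast_card_ne_zero hs.2) ?_
      rw [h1, h2]
      congr 1
      refine Finset.sum_congr rfl fun e he => ?_
      have h3 := hG.lt e
      rw [mem_outEdges.1 he] at h3
      rw [parallel_edge_castSucc]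
      exact ih _ (by omega) _ (by omega) rfl

/-- Same reason as for parallel doubling. The condition `x < G.order` excludes the new node, which
has an outgoing edge only after the doubling. -/
theorem pathGF_serial_of_lt {G : Network n} {h : ℕ → ℕ} (hG : G.Layered h) {u v : ℕ → ℝ[X]}
    (hu : G.IsPathGF u) (j : Fin n) (hv : (G.serial j).IsPathGF v) (x : ℕ) (hxo : x < G.order)
    (hx : h x < h (G.edge j).1) : v x = u x := by
  induction hk : h x using Nat.strong_induction_on generalizing x with
  | _ k ih =>
    by_cases hs : x = sink ∨ G.outEdges x = ∅
    · rw [hu.terminal x hs, hv.terminal x (by rwa [outEdges_serial_eq_empty hxo])]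
    · rw [not_or] at hs
      have h1 := hu.step x hs.1 hs.2
      have h2 := hv.step x hs.1 (by rw [Ne, outEdges_serial_eq_empty hxo]; exact hs.2)
      rw [card_outEdges_serial G j hxo, sum_outEdges_serial G j hxo] at h2
      refine mul_left_cancel₀ (natCast_card_ne_zero hs.2) ?_
      rw [h1, h2]
      congr 1
      refine Finset.sum_congr rfl fun e he => ?_
      have h3 := hG.lt e
      rw [mem_outEdges.1 he] at h3
      have hej : e ≠ j := by
        rintro rfl
        rw [mem_outEdges.1 he] at hx
        exact lt_irrefl _ hx
      rw [serial_edge_castSucc, if_neg hej]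
      exact ih (h (G.edge e).2) (by omega) (G.edge e).2 (hG.head_lt e) (h3.trans hx) rfl

/-- On average, doubling an edge in a parallel way does not change the law of the path length. -/
theorem sum_pathGF_parallel {G : Network n} {h : ℕ → ℕ} (hG : G.Layered h) {u : ℕ → ℝ[X]}
    {v : Fin n → ℕ → ℝ[X]} (hu : G.IsPathGF u) (hv : ∀ j, (G.parallel j).IsPathGF (v j)) (x : ℕ) :
    ∑ j, v j x = n * u x := by
  induction hk : h x using Nat.strong_induction_on generalizing x with
  | _ k ih =>
    by_cases hs : x = sink ∨ G.outEdges x = ∅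
    · rw [hu.terminal x hs,
        Finset.sum_congr rfl fun j _ => (hv j).terminal x (by rwa [outEdges_parallel_eq_empty])]
      simp
    · rw [not_or] at hs
      set O := G.outEdges x with hO
      have hd := natCast_card_ne_zero hs.2
      have hd1 : ((O.card + 1 : ℕ) : ℝ[X]) ≠ 0 := Nat.cast_ne_zero.2 (Nat.succ_ne_zero _)
      have h1 := hu.step x hs.1 hs.2
      have h2 := fun j => (hv j).step x hs.1 (by rw [Ne, outEdges_parallel_eq_empty]; exact hs.2)
      simp only [card_outEdges_parallel, sum_outEdges_parallel, parallel_edge_castSucc,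
        parallel_edge_last, ← hO] at h1 h2
      have hlt : ∀ e ∈ O, h (G.edge e).2 < h x := fun e he => by
        have h3 := hG.lt e
        rwa [mem_outEdges.1 he] at h3
      -- For `j` leaving `x` the out-degree d becomes d + 1 while the values at the heads stay the
      -- same; summed over these `j`, every head is counted d + 1 times.
      have hin : ∑ j ∈ O, v j x = O.card * u x := by
        refine mul_left_cancel₀ hd1 ?_
        rw [Finset.mul_sum]
        have : ∀ j ∈ O, ((O.card + 1 : ℕ) : ℝ[X]) * v j x =
            X * (∑ e ∈ O, u (G.edge e).2 + u (G.edge j).2) := fun j hj => by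
          have h3 := h2 j
          rw [if_pos hj, if_pos hj] at h3
          rw [h3]
          have h4 : ∀ e ∈ O, v j (G.edge e).2 = u (G.edge e).2 := fun e he =>
            pathGF_parallel_of_lt hG hu j (hv j) _ (by rw [mem_outEdges.1 hj]; exact hlt e he)
          rw [h4 j hj, Finset.sum_congr rfl h4]
        rw [Finset.sum_congr rfl this, ← Finset.mul_sum, Finset.sum_add_distrib, Finset.sum_const,
          h1, nsmul_eq_mul]
        push_cast
        ring
      have hout : ∑ j ∈ Oᶜ, v j x = (n - O.card) * u x := by
        refine mul_left_cancel₀ hd ?_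
        rw [Finset.mul_sum]
        have : ∀ j ∈ Oᶜ, (O.card : ℝ[X]) * v j x = X * ∑ e ∈ O, v j (G.edge e).2 := fun j hj => by
          have h3 := h2 j
          rw [Finset.mem_compl] at hj
          rwa [if_neg hj, if_neg hj, add_zero, add_zero] at h3
        rw [Finset.sum_congr rfl this, ← Finset.mul_sum, Finset.sum_comm]
        have h5 : ∀ e ∈ O, ∑ j ∈ Oᶜ, v j (G.edge e).2 = (n - O.card) * u (G.edge e).2 := by
          intro e he
          -- The induction hypothesis sums over all `j`; the share of those leaving `x`, for which
          -- `v j` agrees with `u` at the head, is subtracted.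
          have h6 := ih _ (hk ▸ hlt e he) _ rfl
          rw [← Finset.sum_add_sum_compl O, Finset.sum_congr rfl fun j hj =>
            pathGF_parallel_of_lt hG hu j (hv j) (G.edge e).2
              (by rw [mem_outEdges.1 hj]; exact hlt e he), Finset.sum_const, nsmul_eq_mul] at h6
          linear_combination h6
        rw [Finset.sum_congr rfl h5, ← Finset.mul_sum]
        linear_combination -(n - O.card : ℝ[X]) * h1
      rw [← Finset.sum_add_sum_compl O, hin, hout]
      ring

/-- Doubling a uniformly random edge in a serial way lengthens the path by one edge exactly if the
chosen edge belongs to it. -/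
theorem sum_pathGF_serial {G : Network n} {h : ℕ → ℕ} (hG : G.Layered h) {u : ℕ → ℝ[X]}
    {v : Fin n → ℕ → ℝ[X]} (hu : G.IsPathGF u) (hv : ∀ j, (G.serial j).IsPathGF (v j)) (x : ℕ)
    (hxo : x < G.order) :
    ∑ j, v j x = (n : ℝ[X]) * u x + (X ^ 2 - X) * derivative (u x) := by
  induction hk : h x using Nat.strong_induction_on generalizing x with
  | _ k ih =>
    by_cases hs : x = sink ∨ G.outEdges x = ∅
    · rw [hu.terminal x hs,
        Finset.sum_congr rfl fun j _ => (hv j).terminal x (by rwa [outEdges_serial_eq_empty hxo])]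
      simp
    · rw [not_or] at hs
      set O := G.outEdges x with hO
      have hd := natCast_card_ne_zero hs.2
      have h1 := hu.step x hs.1 hs.2
      have h2 := fun j => (hv j).step x hs.1 (by rw [Ne, outEdges_serial_eq_empty hxo]; exact hs.2)
      simp only [card_outEdges_serial G _ hxo, sum_outEdges_serial G _ hxo, serial_edge_castSucc,
        ← hO] at h1 h2
      have hlt : ∀ e ∈ O, h (G.edge e).2 < h x := fun e he => by
        have h3 := hG.lt e
        rwa [mem_outEdges.1 he] at h3
      have hnew : ∀ j, v j G.order = X * v j (G.edge j).2 := fun j => by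
        have h3 := (hv j).step G.order (by have := hG.two_le; unfold sink; omega)
          (by rw [outEdges_serial_order hG]; simp)
        rw [outEdges_serial_order hG] at h3
        simpa using h3
      -- Only `j = e` redirects `e` to the new node, at the cost of one more step: there X u
      -- replaces u, whence the term (X - 1) u.
      have h4 : ∀ e ∈ O, (∑ j, v j (if e = j then G.order else (G.edge e).2)) =
          (n : ℝ[X]) * u (G.edge e).2 + (X ^ 2 - X) * derivative (u (G.edge e).2) +
            (X - 1) * u (G.edge e).2 := fun e he => by
        rw [← ih _ (hk ▸ hlt e he) _ (hG.head_lt e) rfl,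
          ← Finset.add_sum_erase Finset.univ (fun j => v j (G.edge e).2) (Finset.mem_univ e),
          ← Finset.add_sum_erase Finset.univ _ (Finset.mem_univ e), if_pos rfl, hnew,
          pathGF_serial_of_lt hG hu e (hv e) _ (hG.head_lt e) (hG.lt e),
          Finset.sum_congr rfl fun j hj => by rw [if_neg (Finset.ne_of_mem_erase hj).symm]]
        ring
      -- Differentiating the recursion of `u x` yields the derivatives at the heads; the extra
      -- summand of the product rule is matched by the terms (X - 1) u.
      have h5 := congrArg derivative h1
      simp only [derivative_mul, derivative_natCast, derivative_X, derivative_sum, zero_mul,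
        zero_add, one_mul] at h5
      refine mul_left_cancel₀ hd ?_
      rw [Finset.mul_sum, Finset.sum_congr rfl fun j _ => h2 j, ← Finset.mul_sum, Finset.sum_comm,
        Finset.sum_congr rfl h4, Finset.sum_add_distrib, Finset.sum_add_distrib, ← Finset.mul_sum,
        ← Finset.mul_sum, ← Finset.mul_sum]
      linear_combination -(n : ℝ[X]) * h1 - (X ^ 2 - X) * h5

end Network

/-! ### The recursion for the law of the path length -/

theorem exists_layered_of_mem_support (p : ℝ) (hp : p ∈ Ioo (0 : ℝ) 1) (n : ℕ) :
    ∀ G ∈ (bernoulliNetwork p hp n).support, ∃ h, G.Layered h := by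
  induction n with
  | zero =>
    intro G hG
    rw [bernoulliNetwork, PMF.support_pure, mem_singleton_iff] at hG
    subst hG
    exact ⟨_, Network.single_layered⟩
  | succ n ih =>
    intro G hG
    rw [bernoulliNetwork, PMF.mem_support_bind_iff] at hG
    obtain ⟨H, hH, hG⟩ := hG
    rw [PMF.mem_support_bind_iff] at hG
    obtain ⟨j, -, hG⟩ := hG
    rw [PMF.mem_support_map_iff] at hG
    obtain ⟨b, -, rfl⟩ := hG
    obtain ⟨h, hh⟩ := ih H hH
    cases b
    · exact ⟨_, hh.serial j⟩
    · exact ⟨_, hh.parallel j⟩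

namespace Network

open Polynomial in
/-- The averaged effect of one doubling on the law of the path length. -/
theorem Layered.step_law {n : ℕ} {G : Network (n + 1)} {h : ℕ → ℕ} (hG : G.Layered h) {p : ℝ}
    (hp : p ∈ Ioo (0 : ℝ) 1) (m : ℕ) :
    ((PMF.uniformOfFintype (Fin (n + 1))).bind fun j =>
        ((coin p hp).map fun b => if b then G.parallel j else G.serial j).bind
          fun H => H.randomPath.map List.length) (m + 1) =
      ENNReal.ofReal (1 - (1 - p) * (m + 1) / (n + 1)) * G.randomPath.map List.length (m + 1) +
        ENNReal.ofReal ((1 - p) * m / (n + 1)) * G.randomPath.map List.length m := by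
  have h1p : 0 < 1 - p := by linarith [hp.2]
  have hn : (0 : ℝ) < n + 1 := by positivity
  refine (ENNReal.toReal_eq_toReal_iff' (PMF.apply_ne_top _ _) (ENNReal.add_ne_top.2
    ⟨ENNReal.mul_ne_top ENNReal.ofReal_ne_top (PMF.apply_ne_top _ _),
      ENNReal.mul_ne_top ENNReal.ofReal_ne_top (PMF.apply_ne_top _ _)⟩)).1 ?_
  have hlaw : ∀ {N : ℕ} (H : Network N) (i : ℕ),
      (H.randomPath.map List.length i).toReal = (H.pathPoly N source).coeff i :=
    fun H i => toReal_randomWalk_length H _ _ i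
  have hleft : (((PMF.uniformOfFintype (Fin (n + 1))).bind fun j =>
        ((coin p hp).map fun b => if b then G.parallel j else G.serial j).bind
          fun H => H.randomPath.map List.length) (m + 1)).toReal =
      ∑ j : Fin (n + 1), ((n : ℝ) + 1)⁻¹ *
        (p * ((G.parallel j).pathPoly (n + 2) source).coeff (m + 1) +
          (1 - p) * ((G.serial j).pathPoly (n + 2) source).coeff (m + 1)) := by
    rw [PMF.bind_apply, tsum_fintype, ENNReal.toReal_sum
      fun j _ => ENNReal.mul_ne_top (PMF.apply_ne_top _ _) (PMF.apply_ne_top _ _)]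
    refine Finset.sum_congr rfl fun j _ => ?_
    rw [ENNReal.toReal_mul, PMF.bind_map, PMF.bind_apply, tsum_fintype, Fintype.sum_bool,
      ENNReal.toReal_add (ENNReal.mul_ne_top (PMF.apply_ne_top _ _) (PMF.apply_ne_top _ _))
        (ENNReal.mul_ne_top (PMF.apply_ne_top _ _) (PMF.apply_ne_top _ _)), ENNReal.toReal_mul,
      ENNReal.toReal_mul]
    congr 1
    · rw [PMF.uniformOfFintype_apply, Fintype.card_fin, ENNReal.toReal_inv, ENNReal.toReal_natCast]
      push_cast; rfl
    · simp only [Function.comp, if_true, Bool.false_eq_true, if_false]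
      rw [hlaw, hlaw]
      simp [coin, ENNReal.toReal_ofReal hp.1.le, ENNReal.toReal_ofReal h1p.le]
  have hpar := congrArg (fun q => q.coeff (m + 1)) (sum_pathGF_parallel hG hG.isPathGF
    (fun j => (hG.parallel j).isPathGF) source)
  have hser := congrArg (fun q => q.coeff (m + 1)) (sum_pathGF_serial hG hG.isPathGF
    (fun j => (hG.serial j).isPathGF) source (by have := hG.two_le; unfold source; omega))
  have hc : ∀ (q : ℝ[X]), ((X ^ 2 - X) * derivative q).coeff (m + 1) =
      m * q.coeff m - (m + 1) * q.coeff (m + 1) := fun q => by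
    rw [sub_mul, coeff_sub, coeff_X_mul, coeff_derivative, pow_two, mul_assoc, coeff_X_mul]
    cases m with
    | zero => simp
    | succ m => rw [coeff_X_mul, coeff_derivative]; push_cast; ring
  simp only [finsetSum_coeff, coeff_add, hc, ← C_eq_natCast, coeff_C_mul] at hpar hser
  push_cast at hpar hser
  rw [hleft, ← Finset.mul_sum, Finset.sum_add_distrib, ← Finset.mul_sum, ← Finset.mul_sum, hpar,
    hser, ENNReal.toReal_add (ENNReal.mul_ne_top ENNReal.ofReal_ne_top (PMF.apply_ne_top _ _))
      (ENNReal.mul_ne_top ENNReal.ofReal_ne_top (PMF.apply_ne_top _ _)), ENNReal.toReal_mul,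
    ENNReal.toReal_mul, hlaw, hlaw,
    ENNReal.toReal_ofReal (div_nonneg (mul_nonneg h1p.le m.cast_nonneg) hn.le)]
  -- For m > n the first weight may be negative, and `ENNReal.ofReal` would truncate it; but then no
  -- path has length m + 1.
  by_cases hm : m ≤ n
  · rw [ENNReal.toReal_ofReal]
    · field_simp
      ring
    · rw [sub_nonneg, div_le_one hn]
      have : (m : ℝ) ≤ n := Nat.cast_le.2 hm
      nlinarith [hp.1]
  · have h0 : (G.pathPoly (n + 1) source).coeff (m + 1) = 0 :=
      coeff_eq_zero_of_natDegree_lt ((natDegree_pathPoly_le G _ _).trans_lt (by omega))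
    rw [h0]
    field_simp
    ring

end Network

theorem pathLength_one (p : ℝ) (hp : p ∈ Ioo (0 : ℝ) 1) (m : ℕ) :
    (pathLength p hp 1 m).toReal = if m = 1 then 1 else 0 := by
  have h : Network.single.outEdges 0 = Finset.univ := by
    ext e; simp [Network.outEdges, Network.single, Network.source]
  rw [pathLength, bernoulliNetwork, PMF.pure_bind, Network.randomPath,
    Network.toReal_randomWalk_length, Network.pathPoly, Network.source, h]
  simp [Network.sink, Network.pathPoly, Polynomial.coeff_X, eq_comm]

/-- A length m grows to m + 1 when the doubling is serial and hits the path, which has probability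
(1-p)m/(n+1). After this averaging the networks are no longer needed. -/
theorem pathLength_add_two (p : ℝ) (hp : p ∈ Ioo (0 : ℝ) 1) (n m : ℕ) :
    pathLength p hp (n + 2) (m + 1) =
      ENNReal.ofReal (1 - (1 - p) * (m + 1) / (n + 1)) * pathLength p hp (n + 1) (m + 1) +
        ENNReal.ofReal ((1 - p) * m / (n + 1)) * pathLength p hp (n + 1) m := by
  rw [pathLength, bernoulliNetwork, PMF.bind_bind, PMF.bind_apply, pathLength, PMF.bind_apply,
    PMF.bind_apply, ← ENNReal.tsum_mul_left, ← ENNReal.tsum_mul_left, ← ENNReal.tsum_add]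
  refine tsum_congr fun G => ?_
  by_cases hG : bernoulliNetwork p hp n G = 0
  · simp [hG]
  · obtain ⟨h, hh⟩ := exists_layered_of_mem_support p hp n G hG
    rw [PMF.bind_bind, hh.step_law hp]
    ring

theorem pathLength_eq_zero_of_lt (p : ℝ) (hp : p ∈ Ioo (0 : ℝ) 1) {n m : ℕ} (h : n < m) :
    pathLength p hp n m = 0 := by
  cases n with
  | zero => simp [pathLength, h.ne']
  | succ n =>
    rw [pathLength, PMF.bind_apply, ENNReal.tsum_eq_zero]
    intro G
    rw [mul_eq_zero]
    right
    refine ((ENNReal.toReal_eq_zero_iff _).1 ?_).resolve_right (PMF.apply_ne_top _ _)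
    rw [Network.randomPath, Network.toReal_randomWalk_length]
    exact Polynomial.coeff_eq_zero_of_natDegree_lt
      ((Network.natDegree_pathPoly_le G _ _).trans_lt h)

theorem toReal_pathLength_add_two (p : ℝ) (hp : p ∈ Ioo (0 : ℝ) 1) (n m : ℕ) :
    (pathLength p hp (n + 2) (m + 1)).toReal =
      (1 - (1 - p) * (m + 1) / (n + 1)) * (pathLength p hp (n + 1) (m + 1)).toReal +
        (1 - p) * m / (n + 1) * (pathLength p hp (n + 1) m).toReal := by
  have h1p : 0 < 1 - p := by linarith [hp.2]
  have hn : (0 : ℝ) < n + 1 := by positivity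
  rw [pathLength_add_two, ENNReal.toReal_add (ENNReal.mul_ne_top ENNReal.ofReal_ne_top
    (PMF.apply_ne_top _ _)) (ENNReal.mul_ne_top ENNReal.ofReal_ne_top (PMF.apply_ne_top _ _)),
    ENNReal.toReal_mul, ENNReal.toReal_mul,
    ENNReal.toReal_ofReal (div_nonneg (mul_nonneg h1p.le m.cast_nonneg) hn.le)]
  by_cases hm : m ≤ n
  · rw [ENNReal.toReal_ofReal]
    rw [sub_nonneg, div_le_one hn]
    have : (m : ℝ) ≤ n := Nat.cast_le.2 hm
    nlinarith [hp.1]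
  · rw [pathLength_eq_zero_of_lt p hp (by omega : n + 1 < m + 1)]
    simp

/-! ### The explicit formula -/

theorem sum_choose_mul_neg_one_pow (m : ℕ) :
    ∑ j ∈ Finset.range (m + 1), (m.choose j : ℝ) * (-1) ^ j = if m = 0 then 1 else 0 := by
  have h := (Commute.all (-1 : ℝ) 1).add_pow m
  simp only [one_pow, mul_one, neg_add_cancel] at h
  rw [Finset.sum_congr rfl fun j _ => mul_comm _ _, ← h, zero_pow_eq]

/-- Since m C(m-1, j) = (m-j) C(m, j), the sequence m ↦ C(m, j) is an eigenvector of the recursion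
at every size, and its eigenvalues multiply up to the product. The alternating sum of these
sequences is the point mass at m = 0, the initial law. -/
theorem toReal_pathLength_eq_sum (p : ℝ) (hp : p ∈ Ioo (0 : ℝ) 1) (n m : ℕ) :
    (pathLength p hp (n + 1) (m + 1)).toReal =
      ∑ j ∈ Finset.range (m + 1), (m.choose j : ℝ) * (-1) ^ j *
        ∏ i ∈ Finset.range n, (1 - (1 - p) * (j + 1) / (i + 1)) := by
  induction n generalizing m with
  | zero =>
    simp only [Finset.range_zero, Finset.prod_empty, mul_one]
    rw [pathLength_one, sum_choose_mul_neg_one_pow]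
    simp
  | succ n ih =>
    rw [toReal_pathLength_add_two, ih, Finset.mul_sum]
    have hn : (n : ℝ) + 1 ≠ 0 := by positivity
    cases m with
    | zero => simp [Finset.prod_range_succ, mul_comm]
    | succ m =>
      -- The sum for `m` has no term j = m + 1, so this term is split off on both sides.
      rw [ih m, Finset.mul_sum, Finset.sum_range_succ _ (m + 1),
        Finset.sum_range_succ _ (m + 1), add_right_comm, ← Finset.sum_add_distrib]
      congr 1
      · refine Finset.sum_congr rfl fun j hj => ?_
        have hj : j ≤ m := by simpa [Nat.lt_succ_iff] using hj
        have hc : ((m + 1 : ℕ) : ℝ) * (m.choose j : ℝ) =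
            ((m + 1).choose j : ℝ) * ((m + 1 : ℕ) - j) := by
          have h := Nat.choose_mul_succ_eq m j
          rw [← Nat.cast_sub (by omega), mul_comm]
          exact_mod_cast h
        rw [Finset.prod_range_succ]
        generalize ∏ i ∈ Finset.range n, (1 - (1 - p) * ((j : ℝ) + 1) / ((i : ℝ) + 1)) = P
        generalize (-1 : ℝ) ^ j = s
        push_cast at hc ⊢
        field_simp
        linear_combination (1 - p) * P * s * hc
      · rw [Finset.prod_range_succ]
        push_cast
        ring

/-- The factor a - 1 - i of the falling factorial equals -(i+1)(1 - a/(i+1)). -/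
theorem neg_one_pow_mul_choose (a : ℝ) (n : ℕ) :
    (-1) ^ n * Ring.choose (a - 1) n = ∏ i ∈ Finset.range n, (1 - a / (i + 1)) := by
  rw [Ring.choose_eq_smul]
  induction n with
  | zero => simp
  | succ n ih =>
    have hn : (n : ℝ) + 1 ≠ 0 := by positivity
    rw [Finset.prod_range_succ, ← ih, descPochhammer_succ_right, Nat.factorial_succ,
      pow_succ]
    simp only [Polynomial.smeval_mul, Polynomial.smeval_sub, Polynomial.smeval_X,
      Polynomial.smeval_natCast, smul_eq_mul]
    push_cast
    field_simp
    simp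
    ring

theorem toReal_pathLength_eq (p : ℝ) (hp : p ∈ Ioo (0 : ℝ) 1) (n m : ℕ) (hm : 1 ≤ m)
    (hmn : m ≤ n) :
    (pathLength p hp n m).toReal =
        ∑ j ∈ Finset.range m, ((m - 1).choose j : ℝ) * (-1) ^ (n + j - 1) *
          Ring.choose ((j : ℝ) - p * (j + 1)) (n - 1) := by
  obtain ⟨m, rfl⟩ := Nat.exists_eq_succ_of_ne_zero (by omega : m ≠ 0)
  obtain ⟨n, rfl⟩ := Nat.exists_eq_succ_of_ne_zero (by omega : n ≠ 0)
  simp only [Nat.succ_eq_add_one, Nat.add_sub_cancel] at *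
  rw [toReal_pathLength_eq_sum]
  refine Finset.sum_congr rfl fun j _ => ?_
  rw [← neg_one_pow_mul_choose, show n + 1 + j - 1 = j + n by omega, pow_add,
    show (1 - p) * ((j : ℝ) + 1) - 1 = j - p * (j + 1) by ring]
  ring

/-! ### Moments of the path length -/

/-- The rising factorial moments of the path length. -/
theorem sum_pathLength_mul_ascPochhammer (p : ℝ) (hp : p ∈ Ioo (0 : ℝ) 1) (r n : ℕ) :
    ∑ m ∈ Finset.range (n + 1), (pathLength p hp (n + 1) (m + 1)).toReal *
        (ascPochhammer ℝ r).eval ((m : ℝ) + 1) =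
      r.factorial * ∏ i ∈ Finset.range n, (1 + (1 - p) * r / (i + 1)) := by
  induction n with
  | zero => simp [pathLength_one, ascPochhammer_eval_one]
  | succ n ih =>
    have hn : (n : ℝ) + 1 ≠ 0 := by positivity
    -- This identity makes the rising factorial f an eigenfunction of the adjoint recursion: (1 -
    -- bx) f(x) + bx f(x+1) = (1 + br) f(x).
    have hasc : ∀ x : ℝ, x * (ascPochhammer ℝ r).eval (x + 1) =
        (ascPochhammer ℝ r).eval x * (x + r) := fun x => by
      have h := congrArg (Polynomial.eval x) (ascPochhammer_succ_left ℝ r)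
      rw [ascPochhammer_succ_eval] at h
      simpa using h.symm
    have hq : (pathLength p hp (n + 1) (n + 1 + 1)).toReal = 0 := by
      rw [pathLength_eq_zero_of_lt p hp (Nat.lt_succ_self _)]; rfl
    simp only [toReal_pathLength_add_two, add_mul]
    rw [Finset.sum_add_distrib, Finset.sum_range_succ, hq, Finset.sum_range_succ' _ (n + 1)]
    simp only [Nat.cast_zero, mul_zero, zero_mul, zero_div, add_zero]
    rw [← Finset.sum_add_distrib, Finset.prod_range_succ, ← mul_assoc, ← ih, Finset.sum_mul]
    refine Finset.sum_congr rfl fun m _ => ?_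
    have h := hasc ((m : ℝ) + 1)
    push_cast
    field_simp
    linear_combination (1 - p) * (pathLength p hp (n + 1) (m + 1)).toReal * h

theorem integrable_toMeasure_pathLength {E : Type*} [NormedAddCommGroup E] [NormedSpace ℝ E]
    (p : ℝ) (hp : p ∈ Ioo (0 : ℝ) 1) (n : ℕ) (f : ℕ → E) :
    Integrable f (pathLength p hp n).toMeasure := by
  have hae : ∀ᵐ k ∂(pathLength p hp n).toMeasure, k ∈ Finset.range (n + 1) := by
    rw [ae_iff, PMF.toMeasure_apply_eq_zero_iff _ (MeasurableSet.of_discrete),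
      Set.disjoint_left]
    intro k hk hk'
    apply hk
    exact pathLength_eq_zero_of_lt p hp (by simpa using hk')
  refine Integrable.of_bound AEStronglyMeasurable.of_discrete
    (∑ k ∈ Finset.range (n + 1), ‖f k‖) (hae.mono fun k hk => ?_)
  exact Finset.single_le_sum (f := fun k => ‖f k‖) (fun _ _ => norm_nonneg _) hk

theorem integral_toMeasure_pathLength {E : Type*} [NormedAddCommGroup E] [NormedSpace ℝ E]
    [CompleteSpace E] (p : ℝ) (hp : p ∈ Ioo (0 : ℝ) 1) (n : ℕ) (f : ℕ → E) :
    ∫ k, f k ∂(pathLength p hp n).toMeasure =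
      ∑ k ∈ Finset.range (n + 1), (pathLength p hp n k).toReal • f k := by
  rw [PMF.integral_eq_tsum _ _ (integrable_toMeasure_pathLength p hp n f), tsum_eq_sum]
  intro k hk
  rw [pathLength_eq_zero_of_lt p hp (by simpa using hk)]
  simp

/-- Euler's limit for Γ. `Real.GammaSeq b (n + 1)` contains one factor more than the product, namely
i = n, and dividing by 1 + b/(n+1) → 1 removes it. -/
theorem tendsto_prod_one_add_div {b : ℝ} (hb : 0 < b) :
    Tendsto (fun n : ℕ => (∏ i ∈ Finset.range n, (1 + b / (i + 1))) / ((n : ℝ) + 1) ^ b) atTop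
      (nhds (1 / Real.Gamma (b + 1))) := by
  have hG : Tendsto (fun n : ℕ => (b * Real.GammaSeq b (n + 1))⁻¹ / (1 + b / (n + 1))) atTop
      (nhds ((b * Real.Gamma b)⁻¹ / (1 + 0))) := by
    refine Tendsto.div (((tendsto_const_nhds.mul ((Real.GammaSeq_tendsto_Gamma b).comp
      (tendsto_add_atTop_nat 1)))).inv₀ (mul_pos hb (Real.Gamma_pos_of_pos hb)).ne') ?_ (by simp)
    exact tendsto_const_nhds.add
      (tendsto_const_nhds.div_atTop (tendsto_natCast_atTop_atTop.atTop_add tendsto_const_nhds))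
  rw [Real.Gamma_add_one hb.ne']
  convert hG using 2
  · rename_i n
    have hprod : ∀ n : ℕ, ∏ j ∈ Finset.range (n + 1), (b + (j : ℝ)) =
        b * n.factorial * ∏ i ∈ Finset.range n, (1 + b / ((i : ℝ) + 1)) := fun n => by
      induction n with
      | zero => simp
      | succ n ih =>
        have hn : (n : ℝ) + 1 ≠ 0 := by positivity
        rw [Finset.prod_range_succ, ih, Finset.prod_range_succ, Nat.factorial_succ]
        push_cast
        field_simp
        ring
    have h1 : ((n + 1).factorial : ℝ) ≠ 0 := Nat.cast_ne_zero.2 (Nat.factorial_ne_zero _)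
    have h2 : (0 : ℝ) < ((n : ℝ) + 1) ^ b := by positivity
    have h3 : (0 : ℝ) < 1 + b / (n + 1) := by positivity
    rw [Real.GammaSeq, hprod, Finset.prod_range_succ]
    push_cast
    have h4 : ∏ i ∈ Finset.range n, (1 + b / ((i : ℝ) + 1)) ≠ 0 :=
      Finset.prod_ne_zero_iff.2 fun i _ => by positivity
    generalize ∏ i ∈ Finset.range n, (1 + b / ((i : ℝ) + 1)) = P at *
    generalize 1 + b / ((n : ℝ) + 1) = Q at *
    have := h3.ne'
    have := h2.ne'
    field_simp
  · simp

theorem pow_le_ascPochhammer_eval (r : ℕ) {x : ℝ} (hx : 0 ≤ x) :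
    x ^ r ≤ (ascPochhammer ℝ r).eval x := by
  induction r with
  | zero => simp
  | succ r ih =>
    rw [ascPochhammer_succ_eval, pow_succ]
    exact mul_le_mul ih (by simp) hx ((pow_nonneg hx r).trans ih)

/-- The leading powers cancel, so power moments and rising moments differ by something of lower
order, negligible after rescaling. -/
theorem exists_ascPochhammer_eval_sub_pow_le (r : ℕ) :
    ∃ C : ℝ, ∀ x : ℝ, 0 ≤ x → (ascPochhammer ℝ (r + 1)).eval x - x ^ (r + 1) ≤
      C * (ascPochhammer ℝ r).eval x := by
  induction r with
  | zero => exact ⟨0, fun x _ => by simp⟩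
  | succ r ih =>
    obtain ⟨C, hC⟩ := ih
    refine ⟨max C 0 + (r + 1), fun x hx => ?_⟩
    have h1 := hC x hx
    have h2 := (pow_nonneg hx r).trans (pow_le_ascPochhammer_eval r hx)
    have h3 : x * (ascPochhammer ℝ r).eval x ≤ (ascPochhammer ℝ (r + 1)).eval x := by
      rw [ascPochhammer_succ_eval]
      nlinarith [mul_nonneg (Nat.cast_nonneg r : (0 : ℝ) ≤ r) h2]
    rw [ascPochhammer_succ_eval (r + 1), pow_succ]
    push_cast
    have h4 := mul_le_mul_of_nonneg_left h1 hx
    have h5 := mul_le_mul_of_nonneg_left h3 (le_max_right C 0)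
    have h6 : x * (C * (ascPochhammer ℝ r).eval x) ≤ max C 0 * (x * (ascPochhammer ℝ r).eval x) := by
      have := mul_le_mul_of_nonneg_right (le_max_left C 0) (mul_nonneg hx h2)
      linarith
    linarith

/-- The rescaled moments of the path length converge to the moments of the Mittag-Leffler
distribution. -/
theorem tendsto_moment_pathLength (p : ℝ) (hp : p ∈ Ioo (0 : ℝ) 1) (r : ℕ) :
    Tendsto (fun n : ℕ => ∫ k : ℕ, ((k : ℝ) / (n : ℝ) ^ (1 - p)) ^ r
        ∂(pathLength p hp n).toMeasure) atTop
      (nhds ((r.factorial : ℝ) / Real.Gamma (r * (1 - p) + 1))) := by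
  have h1p : 0 < 1 - p := by linarith [hp.2]
  rcases r with _ | r
  · simp
  have hscale : ∀ r : ℕ, Tendsto (fun n : ℕ => (∑ m ∈ Finset.range (n + 1),
      (pathLength p hp (n + 1) (m + 1)).toReal * (ascPochhammer ℝ r).eval ((m : ℝ) + 1)) /
        ((n : ℝ) + 1) ^ ((1 - p) * r)) atTop
      (nhds ((r.factorial : ℝ) / Real.Gamma (r * (1 - p) + 1))) := fun r => by
    simp only [sum_pathLength_mul_ascPochhammer]
    -- Euler's limit needs a positive parameter, so order zero is treated apart.
    rcases r with _ | r
    · simp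
    · have h := (tendsto_prod_one_add_div (b := (1 - p) * (r + 1 : ℕ)) (by positivity)).const_mul
        ((r + 1).factorial : ℝ)
      rw [mul_one_div, mul_comm (1 - p)] at h
      refine h.congr fun n => ?_
      rw [mul_comm (1 - p), mul_div_assoc]
  -- With the normalization of order r + 1, the rising moment of order r carries an additional
  -- factor (n+1)^{-(1-p)}.
  have hzero : Tendsto (fun n : ℕ => (∑ m ∈ Finset.range (n + 1),
      (pathLength p hp (n + 1) (m + 1)).toReal * (ascPochhammer ℝ r).eval ((m : ℝ) + 1)) /
        ((n : ℝ) + 1) ^ ((1 - p) * (r + 1 : ℕ))) atTop (nhds 0) := by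
    have hinf : Tendsto (fun n : ℕ => ((n : ℝ) + 1) ^ (-(1 - p))) atTop (nhds 0) :=
      (tendsto_rpow_neg_atTop h1p).comp
        (tendsto_natCast_atTop_atTop.atTop_add tendsto_const_nhds)
    have h := (hscale r).mul hinf
    rw [mul_zero] at h
    refine h.congr fun n => ?_
    have hn : (0 : ℝ) < n + 1 := by positivity
    rw [Nat.cast_succ, mul_add, mul_one, Real.rpow_add hn, Real.rpow_neg hn.le, ← div_eq_mul_inv,
      div_div]
  obtain ⟨C, hC⟩ := exists_ascPochhammer_eval_sub_pow_le r
  rw [← tendsto_add_atTop_iff_nat 1]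
  have heq : ∀ n : ℕ, ∫ k : ℕ, ((k : ℝ) / ((n + 1 : ℕ) : ℝ) ^ (1 - p)) ^ (r + 1)
        ∂(pathLength p hp (n + 1)).toMeasure = (∑ m ∈ Finset.range (n + 1),
      (pathLength p hp (n + 1) (m + 1)).toReal * ((m : ℝ) + 1) ^ (r + 1)) /
        ((n : ℝ) + 1) ^ ((1 - p) * (r + 1 : ℕ)) := fun n => by
    rw [integral_toMeasure_pathLength]
    rw [Finset.sum_range_succ', Finset.sum_div]
    have hn : (0 : ℝ) ≤ n + 1 := by positivity
    simp only [Nat.cast_zero, zero_div, smul_eq_mul, zero_pow (Nat.succ_ne_zero r), mul_zero,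
      add_zero, Nat.cast_succ, div_pow, mul_div_assoc]
    refine Finset.sum_congr rfl fun m _ => ?_
    rw [← Real.rpow_natCast (((n : ℝ) + 1) ^ (1 - p)), ← Real.rpow_mul hn, Nat.cast_succ]
  simp only [heq]
  -- Squeeze between the rising factorials f: f_{r+1} - C f_r ≤ x^{r+1} ≤ f_{r+1}.
  have hlow := (hscale (r + 1)).sub (hzero.const_mul C)
  rw [mul_zero, sub_zero] at hlow
  refine tendsto_of_tendsto_of_tendsto_of_le_of_le hlow (hscale (r + 1)) ?_ ?_
  · intro n
    have hn : (0 : ℝ) < ((n : ℝ) + 1) ^ ((1 - p) * (r + 1 : ℕ)) := by positivity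
    dsimp only
    rw [← mul_div_assoc, ← sub_div, div_le_div_iff_of_pos_right hn, Finset.mul_sum,
      ← Finset.sum_sub_distrib]
    refine Finset.sum_le_sum fun m _ => ?_
    have := mul_le_mul_of_nonneg_left (hC ((m : ℝ) + 1) (by positivity))
      (ENNReal.toReal_nonneg (a := pathLength p hp (n + 1) (m + 1)))
    linarith
  · intro n
    have hn : (0 : ℝ) < ((n : ℝ) + 1) ^ ((1 - p) * (r + 1 : ℕ)) := by positivity
    dsimp only
    rw [div_le_div_iff_of_pos_right hn]
    refine Finset.sum_le_sum fun m _ => ?_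
    exact mul_le_mul_of_nonneg_left (pow_le_ascPochhammer_eval _ (by positivity))
      ENNReal.toReal_nonneg

/-! ### Taylor remainders and the method of moments -/

theorem norm_exp_mul_I_sub_sum_le_of_nonneg (s : ℝ) (hs : |s| = 1) (R : ℕ) (x : ℝ) (hx : 0 ≤ x) :
    ‖Complex.exp (s * x * Complex.I) -
      ∑ m ∈ Finset.range R, (s * x * Complex.I) ^ m / (m.factorial : ℂ)‖ ≤ x ^ R / R.factorial := by
  induction R generalizing x with
  | zero =>
    have h := Complex.norm_exp_ofReal_mul_I (s * x)
    push_cast at h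
    simp [h]
  | succ R ih =>
    -- The derivative of the remainder of order R + 1 is si times that of order R, so the induction
    -- hypothesis can be integrated; s = ±1 serves both half-lines.
    have hd : ∀ x : ℝ, HasDerivAt (fun y : ℝ => Complex.exp (s * y * Complex.I) -
        ∑ m ∈ Finset.range (R + 1), (s * y * Complex.I) ^ m / (m.factorial : ℂ))
        (s * Complex.I * (Complex.exp (s * x * Complex.I) -
          ∑ m ∈ Finset.range R, (s * x * Complex.I) ^ m / (m.factorial : ℂ))) x := fun x => by
      have h1 : HasDerivAt (fun y : ℝ => (s * y * Complex.I : ℂ)) (s * Complex.I) x := by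
        have := ((Complex.ofRealCLM.hasDerivAt (x := x)).const_mul (s : ℂ)).mul_const Complex.I
        simpa using this
      have h2 := h1.cexp
      have h3 : HasDerivAt (fun y : ℝ => ∑ m ∈ Finset.range (R + 1),
          (s * y * Complex.I) ^ m / (m.factorial : ℂ)) (∑ m ∈ Finset.range (R + 1),
          (m * (s * x * Complex.I) ^ (m - 1) * (s * Complex.I)) / (m.factorial : ℂ)) x :=
        HasDerivAt.fun_sum fun m _ => (h1.pow m).div_const _
      refine (h2.fun_sub h3).congr_deriv ?_
      rw [Finset.sum_range_succ', mul_sub, Finset.mul_sum]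
      simp only [Nat.cast_zero, zero_mul, zero_div, add_zero, Nat.add_sub_cancel,
        Nat.factorial_succ]
      congr 1
      · ring
      · refine Finset.sum_congr rfl fun m _ => ?_
        have h4 : (m.factorial : ℂ) ≠ 0 := Nat.cast_ne_zero.2 (Nat.factorial_ne_zero m)
        have h5 : (m : ℂ) + 1 ≠ 0 := Nat.cast_add_one_ne_zero m
        push_cast
        field_simp
    have hB : ∀ y : ℝ, HasDerivAt (fun y : ℝ => y ^ (R + 1) / ((R + 1).factorial : ℝ))
        (y ^ R / R.factorial) y := fun y => by
      refine ((hasDerivAt_pow (R + 1) y).div_const ((R + 1).factorial : ℝ)).congr_deriv ?_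
      have h4 : (R.factorial : ℝ) ≠ 0 := Nat.cast_ne_zero.2 (Nat.factorial_ne_zero R)
      have h5 : (R : ℝ) + 1 ≠ 0 := Nat.cast_add_one_ne_zero R
      rw [Nat.factorial_succ]
      push_cast
      field_simp
    refine image_norm_le_of_norm_deriv_right_le_deriv_boundary (a := 0) (b := x)
      (fun y _ => (hd y).continuousAt.continuousWithinAt) (fun y _ => (hd y).hasDerivWithinAt)
      ?_ hB (fun y hy => ?_) (right_mem_Icc.2 hx)
    · simp [Finset.sum_range_succ']
    · rw [norm_mul, norm_mul, Complex.norm_I, Complex.norm_real, Real.norm_eq_abs, hs, one_mul,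
        one_mul]
      exact ih y hy.1

theorem norm_exp_mul_I_sub_sum_le (R : ℕ) (x : ℝ) :
    ‖Complex.exp (x * Complex.I) -
      ∑ m ∈ Finset.range R, (x * Complex.I) ^ m / (m.factorial : ℂ)‖ ≤ |x| ^ R / R.factorial := by
  rcases le_total 0 x with hx | hx
  · have h := norm_exp_mul_I_sub_sum_le_of_nonneg 1 (by simp) R x hx
    rw [abs_of_nonneg hx]
    simpa using h
  · have h := norm_exp_mul_I_sub_sum_le_of_nonneg (-1) (by simp) R (-x) (by linarith)
    rw [abs_of_nonpos hx]
    simpa using h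

/-- The Taylor expansion of a weighted characteristic function, with remainder. -/
theorem norm_integral_exp_mul_I_sub_sum_le {ν : Measure ℝ} {w : ℝ → ℝ}
    (hw : ∀ r : ℕ, Integrable (fun x => x ^ r * w x) ν) (t : ℝ) (R : ℕ) :
    ‖(∫ x, Complex.exp (t * x * Complex.I) * w x ∂ν) -
      ∑ m ∈ Finset.range R, (t * Complex.I) ^ m / (m.factorial : ℂ) * (∫ x, x ^ m * w x ∂ν : ℝ)‖ ≤
      |t| ^ R / R.factorial * ∫ x, |x| ^ R * |w x| ∂ν := by
  have hw0 : Integrable w ν := by simpa using hw 0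
  have h1 : Integrable (fun x : ℝ => Complex.exp (t * x * Complex.I) * w x) ν := by
    refine hw0.ofReal.bdd_mul (c := 1) (by fun_prop) (ae_of_all _ fun x => ?_)
    have h := Complex.norm_exp_ofReal_mul_I (t * x)
    push_cast at h
    exact h.le
  have h2 : ∀ m : ℕ, Integrable (fun x : ℝ => (t * Complex.I) ^ m / (m.factorial : ℂ) *
      ((x ^ m * w x : ℝ) : ℂ)) ν := fun m => (hw m).ofReal.const_mul _
  have h3 : Integrable (fun x => |x| ^ R * |w x|) ν := by
    simpa [abs_mul] using (hw R).abs
  have h4 : (∫ x, Complex.exp (t * x * Complex.I) * w x ∂ν) - ∑ m ∈ Finset.range R,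
      (t * Complex.I) ^ m / (m.factorial : ℂ) * (∫ x, x ^ m * w x ∂ν : ℝ) =
      ∫ x, (Complex.exp (t * x * Complex.I) - ∑ m ∈ Finset.range R,
        (t * x * Complex.I) ^ m / (m.factorial : ℂ)) * w x ∂ν := by
    simp_rw [← integral_complex_ofReal, ← integral_const_mul]
    rw [← integral_finsetSum _ fun m _ => h2 m, ← integral_sub h1
      (integrable_finsetSum _ fun m _ => h2 m)]
    congr 1 with x
    rw [sub_mul, Finset.sum_mul]
    congr 1
    refine Finset.sum_congr rfl fun m _ => ?_
    push_cast
    ring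
  rw [h4, ← integral_const_mul]
  refine norm_integral_le_of_norm_le (h3.const_mul _) (ae_of_all _ fun x => ?_)
  have h5 := norm_exp_mul_I_sub_sum_le R (t * x)
  push_cast at h5
  rw [norm_mul, Complex.norm_real, Real.norm_eq_abs]
  refine (mul_le_mul_of_nonneg_right h5 (abs_nonneg _)).trans_eq ?_
  rw [abs_mul, mul_pow]
  ring

/-- A density on the positive half-line, possibly signed, that decays faster than every
exponential. -/
structure SuperexpDecay (g : ℝ → ℝ) : Prop where
  measurable : Measurable g
  continuousOn : ContinuousOn g (Ioi 0)
  bound : ∀ K : ℝ, ∃ C : ℝ, ∀ x : ℝ, 0 < x → |g x| ≤ C * Real.exp (-K * x)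

theorem integrableOn_pow_mul_exp_neg {K : ℝ} (hK : 0 < K) (r : ℕ) :
    IntegrableOn (fun x : ℝ => x ^ r * Real.exp (-K * x)) (Ioi 0) := by
  have h := integrableOn_rpow_mul_exp_neg_mul_rpow (p := 1) (s := r) (b := K)
    (by have : (0 : ℝ) ≤ r := r.cast_nonneg
        linarith) one_pos hK
  simpa using h

theorem integral_pow_mul_exp_neg {K : ℝ} (hK : 0 < K) (r : ℕ) :
    ∫ x in Ioi (0 : ℝ), x ^ r * Real.exp (-K * x) = r.factorial / K ^ (r + 1) := by
  have h := Real.integral_rpow_mul_exp_neg_mul_Ioi (a := r + 1) (r := K) (by positivity) hK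
  rw [Real.Gamma_nat_eq_factorial] at h
  simp only [add_sub_cancel_right, Real.rpow_natCast, neg_mul] at h ⊢
  rw [h]
  have : ((r : ℝ) + 1) = ((r + 1 : ℕ) : ℝ) := by push_cast; rfl
  rw [this, Real.rpow_natCast, one_div, inv_pow]
  field_simp

theorem SuperexpDecay.integrable_pow {g : ℝ → ℝ} (hg : SuperexpDecay g) (r : ℕ) :
    IntegrableOn (fun x => x ^ r * g x) (Ioi 0) := by
  obtain ⟨C, hC⟩ := hg.bound 1
  refine ((integrableOn_pow_mul_exp_neg one_pos r).const_mul C).mono'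
    ((measurable_id.pow_const r).mul hg.measurable).aestronglyMeasurable
    ((ae_restrict_iff' measurableSet_Ioi).2 (ae_of_all _ fun x hx => ?_))
  have hx : 0 < x := hx
  rw [norm_mul, Real.norm_eq_abs, Real.norm_eq_abs, abs_of_nonneg (by positivity)]
  have := mul_le_mul_of_nonneg_left (hC x hx) (pow_nonneg hx.le r)
  linarith

theorem SuperexpDecay.integrable_abs_pow {g : ℝ → ℝ} (hg : SuperexpDecay g) (r : ℕ) :
    IntegrableOn (fun x => |x| ^ r * |g x|) (Ioi 0) := by
  have h := (hg.integrable_pow r).abs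
  simp only [abs_mul, abs_pow] at h
  exact h

/-- Decay at the rate |t| + 1 bounds the R-th absolute moment by C R!/(|t|+1)^{R+1}, so the
remainder is geometric with ratio |t|/(|t|+1) < 1. Decay at every rate allows every t. -/
theorem SuperexpDecay.tendsto_remainder {g : ℝ → ℝ} (hg : SuperexpDecay g) (t : ℝ) :
    Tendsto (fun R : ℕ => |t| ^ R / R.factorial * ∫ x in Ioi (0 : ℝ), |x| ^ R * |g x|) atTop
      (nhds 0) := by
  have hK : 0 < |t| + 1 := by positivity
  obtain ⟨C, hC⟩ := hg.bound (|t| + 1)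
  have hlim : Tendsto (fun R : ℕ => C / (|t| + 1) * (|t| / (|t| + 1)) ^ R) atTop (nhds 0) := by
    have := (tendsto_pow_atTop_nhds_zero_of_lt_one (r := |t| / (|t| + 1)) (by positivity)
      ((div_lt_one hK).2 (by linarith))).const_mul (C / (|t| + 1))
    simpa using this
  refine tendsto_of_tendsto_of_tendsto_of_le_of_le tendsto_const_nhds hlim
    (fun R => mul_nonneg (by positivity) (integral_nonneg fun x => by positivity)) (fun R => ?_)
  have h1 : ∫ x in Ioi (0 : ℝ), |x| ^ R * |g x| ≤ C * (R.factorial / (|t| + 1) ^ (R + 1)) := by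
    rw [← integral_pow_mul_exp_neg hK, ← integral_const_mul]
    refine setIntegral_mono_on (hg.integrable_abs_pow R)
      ((integrableOn_pow_mul_exp_neg hK R).const_mul C) measurableSet_Ioi fun x hx => ?_
    have hx : 0 < x := hx
    rw [abs_of_pos hx]
    have := mul_le_mul_of_nonneg_left (hC x hx) (pow_nonneg hx.le R)
    linarith
  refine (mul_le_mul_of_nonneg_left h1 (by positivity)).trans_eq ?_
  have h4 : (R.factorial : ℝ) ≠ 0 := Nat.cast_ne_zero.2 (Nat.factorial_ne_zero R)
  rw [div_pow, pow_succ]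
  field_simp

/-- Convergence of all moments to those of a superexponentially decaying density implies
convergence of the characteristic functions. -/
theorem SuperexpDecay.tendsto_charFun {g : ℝ → ℝ} (hg : SuperexpDecay g) {ι : Type*}
    {l : Filter ι} {μ : ι → ProbabilityMeasure ℝ}
    (hint : ∀ i (r : ℕ), Integrable (fun x : ℝ => x ^ r) (μ i : Measure ℝ))
    (hm : ∀ r : ℕ, Tendsto (fun i => ∫ x, x ^ r ∂(μ i : Measure ℝ)) l
      (nhds (∫ x in Ioi (0 : ℝ), x ^ r * g x))) (t : ℝ) :
    Tendsto (fun i => charFun (μ i : Measure ℝ) t) l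
      (nhds (∫ x in Ioi (0 : ℝ), Complex.exp (t * x * Complex.I) * g x)) := by
  rw [Metric.tendsto_nhds]
  intro ε hε
  have hlim := (hg.tendsto_remainder t).eventually (gt_mem_nhds (half_pos hε))
  -- For even R the absolute moment of order R is the moment itself, whose convergence is assumed.
  obtain ⟨R, hR, heven⟩ := (hlim.and_frequently Nat.frequently_even).exists
  set A := |t| ^ R / R.factorial * ∫ x in Ioi (0 : ℝ), |x| ^ R * |g x| with hA
  set S : (ℕ → ℝ) → ℂ := fun M => ∑ m ∈ Finset.range R,
    (t * Complex.I) ^ m / (m.factorial : ℂ) * (M m : ℂ) with hS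
  -- The total error: Taylor remainder for `μ i`, distance of the Taylor polynomials, remainder for
  -- `g`. In the limit the first and last are at most A < ε/2 and the middle one vanishes.
  have hB : Tendsto (fun i => |t| ^ R / R.factorial * (∫ x, x ^ R ∂(μ i : Measure ℝ)) +
      ‖S (fun m => ∫ x, x ^ m ∂(μ i : Measure ℝ)) -
        S (fun m => ∫ x in Ioi (0 : ℝ), x ^ m * g x)‖ + A) l
      (nhds (|t| ^ R / R.factorial * (∫ x in Ioi (0 : ℝ), x ^ R * g x) + 0 + A)) := by
    refine (((hm R).const_mul _).add ?_).add tendsto_const_nhds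
    have h1 : Tendsto (fun i => S (fun m => ∫ x, x ^ m ∂(μ i : Measure ℝ))) l
        (nhds (S (fun m => ∫ x in Ioi (0 : ℝ), x ^ m * g x))) :=
      tendsto_finsetSum _ fun m _ =>
        ((Complex.continuous_ofReal.tendsto _).comp (hm m)).const_mul _
    simpa using (h1.sub_const (S (fun m => ∫ x in Ioi (0 : ℝ), x ^ m * g x))).norm
  have hlt : |t| ^ R / R.factorial * (∫ x in Ioi (0 : ℝ), x ^ R * g x) + 0 + A < ε := by
    have h2 : |t| ^ R / R.factorial * (∫ x in Ioi (0 : ℝ), x ^ R * g x) ≤ A := by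
      refine mul_le_mul_of_nonneg_left ?_ (by positivity)
      refine setIntegral_mono_on (hg.integrable_pow R)
        (hg.integrable_abs_pow R) measurableSet_Ioi fun x _ => ?_
      rw [heven.pow_abs]
      exact mul_le_mul_of_nonneg_left (le_abs_self _) (heven.pow_nonneg x)
    linarith
  filter_upwards [hB.eventually (gt_mem_nhds hlt)] with i hi
  refine lt_of_le_of_lt ?_ hi
  have h3 := norm_integral_exp_mul_I_sub_sum_le (ν := (μ i : Measure ℝ)) (w := fun _ => 1)
    (fun r => by simpa using hint i r) t R
  have h4 := norm_integral_exp_mul_I_sub_sum_le (ν := volume.restrict (Ioi (0 : ℝ))) (w := g)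
    hg.integrable_pow t R
  simp only [mul_one, Complex.ofReal_one, abs_one] at h3
  rw [show ∫ x, |x| ^ R ∂(μ i : Measure ℝ) = ∫ x, x ^ R ∂(μ i : Measure ℝ) by
    simp_rw [heven.pow_abs]] at h3
  rw [dist_eq_norm, charFun_apply_real]
  have h5 := norm_sub_le_norm_sub_add_norm_sub (∫ x, Complex.exp (t * x * Complex.I) ∂(μ i : Measure ℝ))
    (S (fun m => ∫ x, x ^ m ∂(μ i : Measure ℝ)))
    (∫ x in Ioi (0 : ℝ), Complex.exp (t * x * Complex.I) * g x)
  have h6 := norm_sub_le_norm_sub_add_norm_sub (S (fun m => ∫ x, x ^ m ∂(μ i : Measure ℝ)))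
    (S (fun m => ∫ x in Ioi (0 : ℝ), x ^ m * g x))
    (∫ x in Ioi (0 : ℝ), Complex.exp (t * x * Complex.I) * g x)
  rw [norm_sub_rev (S (fun m => ∫ x in Ioi (0 : ℝ), x ^ m * g x))] at h6
  linarith

theorem isFiniteMeasure_withDensity_ofReal_of_integrable {ν : Measure ℝ} {w : ℝ → ℝ}
    (hw : Integrable w ν) : IsFiniteMeasure (ν.withDensity fun x => ENNReal.ofReal (w x)) :=
  isFiniteMeasure_withDensity_ofReal hw.2

theorem charFun_withDensity_ofReal {ν : Measure ℝ} {w : ℝ → ℝ} (hw : Measurable w) (t : ℝ) :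
    charFun (ν.withDensity fun x => ENNReal.ofReal (w x)) t =
      ∫ x, Complex.exp (t * x * Complex.I) * (max (w x) 0 : ℝ) ∂ν := by
  rw [charFun_apply_real, integral_withDensity_eq_integral_toReal_smul
    hw.ennreal_ofReal (ae_of_all _ fun _ => ENNReal.ofReal_lt_top)]
  refine integral_congr_ae (ae_of_all _ fun x => ?_)
  simp only [ENNReal.toReal_ofReal', Complex.real_smul]
  ring

theorem integrable_exp_mul_I_mul {ν : Measure ℝ} {w : ℝ → ℝ} (hw : Integrable w ν) (t : ℝ) :
    Integrable (fun x : ℝ => Complex.exp (t * x * Complex.I) * w x) ν := by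
  refine hw.ofReal.bdd_mul (c := 1) (by fun_prop) (ae_of_all _ fun x => ?_)
  have h := Complex.norm_exp_ofReal_mul_I (t * x)
  push_cast at h
  exact h.le

/-- If the characteristic functions of probability measures converge to the Fourier transform of a
signed density, then the latter is the density of a probability measure. -/
theorem exists_probabilityMeasure_of_tendsto_charFun {ν : Measure ℝ} {w : ℝ → ℝ}
    (hwm : Measurable w) (hw : Integrable w ν) {μ : ℕ → ProbabilityMeasure ℝ}
    (h : ∀ t : ℝ, Tendsto (fun n => charFun (μ n : Measure ℝ) t) atTop
      (nhds (∫ x, Complex.exp (t * x * Complex.I) * w x ∂ν))) :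
    (∀ᵐ x ∂ν, 0 ≤ w x) ∧ ∃ L : ProbabilityMeasure ℝ, Tendsto μ atTop (nhds L) ∧
      (L : Measure ℝ) = ν.withDensity fun x => ENNReal.ofReal (w x) := by
  have hcont : Continuous fun t : ℝ => ∫ x, Complex.exp (t * x * Complex.I) * w x ∂ν := by
    refine continuous_of_dominated (bound := fun x => |w x|)
      (fun t => (integrable_exp_mul_I_mul hw t).aestronglyMeasurable) (fun t => ?_) hw.abs
      (ae_of_all _ fun x => by fun_prop)
    refine ae_of_all _ fun x => ?_
    have h := Complex.norm_exp_ofReal_mul_I (t * x)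
    push_cast at h
    rw [norm_mul, h, one_mul, Complex.norm_real, Real.norm_eq_abs]
  -- Lévy: a pointwise limit of characteristic functions that is continuous at 0 forces tightness.
  have htight := isTightMeasureSet_of_tendsto_charFun (μ := fun n => (μ n : Measure ℝ))
    hcont.continuousAt h
  have hcompact : IsCompact (closure (range μ)) := by
    refine isCompact_closure_of_isTightMeasureSet ?_
    convert htight using 1
    ext m
    simp
  -- A limit along a free ultrafilter does the work of a convergent subsequence.
  obtain ⟨L, -, hL⟩ := hcompact.ultrafilter_le_nhds ((hyperfilter ℕ).map μ)
    (by
      rw [le_principal_iff]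
      exact mem_of_superset (mem_map.2 (Filter.Eventually.of_forall fun n => mem_range_self n))
        subset_closure)
  have hL' : Tendsto μ (hyperfilter ℕ : Filter ℕ) (nhds L) := hL
  have hchar : ∀ t : ℝ, charFun (L : Measure ℝ) t = ∫ x, Complex.exp (t * x * Complex.I) * w x ∂ν :=
    fun t => by
      rw [ProbabilityMeasure.tendsto_iff_forall_integral_rclike_tendsto ℂ] at hL'
      have h1 := hL' (BoundedContinuousFunction.innerProbChar t)
      simp_rw [← charFun_eq_integral_innerProbChar] at h1
      exact tendsto_nhds_unique h1 ((h t).mono_left (Nat.hyperfilter_le_atTop))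
  have := isFiniteMeasure_withDensity_ofReal_of_integrable hw
  have := isFiniteMeasure_withDensity_ofReal_of_integrable hw.neg
  -- The negative part of `w` is moved to the side of `L`, so that both sides are positive finite
  -- measures and characteristic functions determine them.
  have heq : (L : Measure ℝ) + ν.withDensity (fun x => ENNReal.ofReal ((-w) x)) =
      ν.withDensity (fun x => ENNReal.ofReal (w x)) := by
    refine Measure.ext_of_charFun (funext fun t => ?_)
    have h1 : charFun ((L : Measure ℝ) + ν.withDensity (fun x => ENNReal.ofReal ((-w) x))) t =
        charFun (L : Measure ℝ) t + charFun (ν.withDensity fun x => ENNReal.ofReal ((-w) x)) t := by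
      simp only [charFun_apply]
      exact integral_add_measure (BoundedContinuousFunction.integrable _
        (BoundedContinuousFunction.innerProbChar t)) (BoundedContinuousFunction.integrable _
        (BoundedContinuousFunction.innerProbChar t))
    rw [h1, hchar, charFun_withDensity_ofReal hwm, charFun_withDensity_ofReal hwm.neg,
      ← integral_add (integrable_exp_mul_I_mul hw t) (integrable_exp_mul_I_mul hw.neg.pos_part t)]
    refine integral_congr_ae (ae_of_all _ fun x => ?_)
    simp only [Pi.neg_apply]
    rw [← mul_add, ← Complex.ofReal_add]
    congr 2
    rcases le_total 0 (w x) with hx | hx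
    · rw [max_eq_left hx, max_eq_right (by linarith)]; ring
    · rw [max_eq_right hx, max_eq_left (by linarith)]; ring
  have hs : MeasurableSet {x | w x < 0} := hwm measurableSet_Iio
  -- The measure with density w⁺ does not charge {w < 0} and, by `heq`, dominates the one with
  -- density w⁻; hence w⁻ = 0 almost everywhere.
  have h0 : ν.withDensity (fun x => ENNReal.ofReal (w x)) {x | w x < 0} = 0 := by
    rw [withDensity_apply _ hs]
    refine (setLIntegral_congr_fun hs fun x hx => ?_).trans lintegral_zero
    exact ENNReal.ofReal_of_nonpos (le_of_lt hx)
  have h1 : ν.withDensity (fun x => ENNReal.ofReal ((-w) x)) {x | w x < 0} = 0 := by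
    rw [← heq, Measure.add_apply, add_eq_zero] at h0
    exact h0.2
  rw [withDensity_apply_eq_zero' hwm.neg.ennreal_ofReal.aemeasurable] at h1
  have hnn : ∀ᵐ x ∂ν, 0 ≤ w x := by
    rw [ae_iff]
    refine measure_mono_null (fun x hx => ?_) h1
    have hx : w x < 0 := not_le.1 hx
    exact ⟨by simpa using hx, hx⟩
  have hLeq : (L : Measure ℝ) = ν.withDensity (fun x => ENNReal.ofReal (w x)) := by
    rw [← heq, (withDensity_eq_zero_iff hwm.neg.ennreal_ofReal.aemeasurable).2, add_zero]
    filter_upwards [hnn] with x hx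
    simpa using hx
  refine ⟨hnn, L, ?_, hLeq⟩
  refine ProbabilityMeasure.tendsto_of_tendsto_charFun fun t => ?_
  rw [hchar]
  exact h t

theorem nonneg_of_ae_nonneg_of_continuousOn {g : ℝ → ℝ} (hg : ContinuousOn g (Ioi 0))
    (h : ∀ᵐ x ∂volume.restrict (Ioi (0 : ℝ)), 0 ≤ g x) : ∀ x : ℝ, 0 < x → 0 ≤ g x := by
  by_contra! hcon
  obtain ⟨x, hx, hgx⟩ := hcon
  have hopen : IsOpen (Ioi (0 : ℝ) ∩ g ⁻¹' Iio 0) := hg.isOpen_inter_preimage isOpen_Ioi isOpen_Iio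
  have hpos := hopen.measure_pos volume ⟨x, hx, hgx⟩
  rw [ae_restrict_iff' measurableSet_Ioi, ae_iff] at h
  refine hpos.ne' (measure_mono_null (fun y hy => ?_) h)
  simp only [mem_ofPred_eq, not_forall, not_le]
  exact ⟨hy.1, hy.2⟩

/-- The **method of moments** for a limit with a superexponentially decaying density; the density
is not assumed to be nonnegative, and this is part of the conclusion. -/
theorem SuperexpDecay.method_of_moments {g : ℝ → ℝ} (hg : SuperexpDecay g)
    {μ : ℕ → ProbabilityMeasure ℝ}
    (hint : ∀ n (r : ℕ), Integrable (fun x : ℝ => x ^ r) (μ n : Measure ℝ))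
    (hm : ∀ r : ℕ, Tendsto (fun n => ∫ x, x ^ r ∂(μ n : Measure ℝ)) atTop
      (nhds (∫ x in Ioi (0 : ℝ), x ^ r * g x))) :
    (∀ x : ℝ, 0 < x → 0 ≤ g x) ∧ ∃ L : ProbabilityMeasure ℝ, Tendsto μ atTop (nhds L) ∧
      (L : Measure ℝ) = (volume.restrict (Ioi 0)).withDensity (fun x => ENNReal.ofReal (g x)) ∧
      (∀ r : ℕ, Integrable (fun x : ℝ => x ^ r) (L : Measure ℝ) ∧
        ∫ x, x ^ r ∂(L : Measure ℝ) = ∫ x in Ioi (0 : ℝ), x ^ r * g x) ∧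
      ∀ L' : ProbabilityMeasure ℝ, (∀ r : ℕ, Integrable (fun x : ℝ => x ^ r) (L' : Measure ℝ) ∧
        ∫ x, x ^ r ∂(L' : Measure ℝ) = ∫ x in Ioi (0 : ℝ), x ^ r * g x) → L' = L := by
  have hgi : Integrable g (volume.restrict (Ioi (0 : ℝ))) := by
    have h := hg.integrable_pow 0
    simp only [pow_zero, one_mul] at h
    exact h
  obtain ⟨hae, L, hL, hLeq⟩ := exists_probabilityMeasure_of_tendsto_charFun hg.measurable hgi
    (hg.tendsto_charFun hint hm)
  have hL1 : ∀ r : ℕ, Integrable (fun x : ℝ => x ^ r) (L : Measure ℝ) ∧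
        ∫ x, x ^ r ∂(L : Measure ℝ) = ∫ x in Ioi (0 : ℝ), x ^ r * g x := fun r => by
    have hcongr : (fun x => (ENNReal.ofReal (g x)).toReal • x ^ r) =ᵐ[volume.restrict (Ioi (0 : ℝ))]
        fun x => x ^ r * g x := by
      filter_upwards [hae] with x hx
      rw [ENNReal.toReal_ofReal hx, smul_eq_mul, mul_comm]
    rw [hLeq]
    constructor
    · rw [integrable_withDensity_iff_integrable_smul' hg.measurable.ennreal_ofReal
        (ae_of_all _ fun _ => ENNReal.ofReal_lt_top)]
      exact (hg.integrable_pow r).congr hcongr.symm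
    · rw [integral_withDensity_eq_integral_toReal_smul hg.measurable.ennreal_ofReal
        (ae_of_all _ fun _ => ENNReal.ofReal_lt_top)]
      exact integral_congr_ae hcongr
  refine ⟨nonneg_of_ae_nonneg_of_continuousOn hg.continuousOn hae, L, hL, hLeq, hL1,
    fun L' hL' => ?_⟩
  have hchar : ∀ M : ProbabilityMeasure ℝ, (∀ r : ℕ, Integrable (fun x : ℝ => x ^ r) (M : Measure ℝ) ∧
      ∫ x, x ^ r ∂(M : Measure ℝ) = ∫ x in Ioi (0 : ℝ), x ^ r * g x) → ∀ t,
      charFun (M : Measure ℝ) t = ∫ x in Ioi (0 : ℝ), Complex.exp (t * x * Complex.I) * g x :=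
    fun M hM t => by
      -- Taken as a constant sequence, a law with these moments has its characteristic function
      -- prescribed.
      have h := hg.tendsto_charFun (l := (atTop : Filter ℕ)) (μ := fun _ => M)
        (fun _ r => (hM r).1) (fun r => by rw [(hM r).2]; exact tendsto_const_nhds) t
      exact tendsto_nhds_unique tendsto_const_nhds h
  have heq : (L' : Measure ℝ) = (L : Measure ℝ) :=
    Measure.ext_of_charFun (funext fun t => by rw [hchar L' hL', hchar L hL1])
  exact Subtype.ext heq

/-! ### Contour integrals through primitives on strips -/

/-- The filter of complex numbers with real part tending to `+∞` and imaginary part in `[a, b]`. -/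
def stripEnd (a b : ℝ) : Filter ℂ :=
  comap Complex.re atTop ⊓ 𝓟 {w | w.im ∈ Icc a b}

theorem tendsto_stripEnd {ι : Type*} {l : Filter ι} {γ : ι → ℂ} {a b : ℝ}
    (hre : Tendsto (fun i => (γ i).re) l atTop) (him : ∀ᶠ i in l, (γ i).im ∈ Icc a b) :
    Tendsto γ l (stripEnd a b) :=
  tendsto_inf.2 ⟨tendsto_comap_iff.2 hre, tendsto_principal.2 him⟩

theorem tendsto_ray_stripEnd {a b ψ : ℝ} (hψ : ψ ∈ Icc a b) :
    Tendsto (fun v : ℝ => (v + ψ * Complex.I : ℂ)) atTop (stripEnd a b) :=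
  tendsto_stripEnd (by simpa using! tendsto_id) (Eventually.of_forall fun v => by simpa using hψ)

theorem stripEnd_neBot {a b : ℝ} (h : a ≤ b) : (stripEnd a b).NeBot :=
  (tendsto_ray_stripEnd (left_mem_Icc.2 h)).neBot

theorem hasDerivAt_horizontal {Φ F : ℂ → ℂ} (hΦ : ∀ w, HasDerivAt Φ (F w) w) (z : ℂ) (v : ℝ) :
    HasDerivAt (fun v : ℝ => Φ (v + z)) (F (v + z)) v := by
  have h : HasDerivAt (fun v : ℝ => (v + z : ℂ)) 1 v := by
    simpa using (Complex.ofRealCLM.hasDerivAt (x := v)).add_const z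
  exact (HasDerivAt.comp_of_eq v (hΦ (v + z)) h rfl).congr_deriv (mul_one _)

/-- On the bottom edge integrability gives a limit. The rest of the strip is joined to this edge by
vertical segments of length at most b - a, on which `F` is O(e^{-Re w}). -/
theorem exists_tendsto_stripEnd {Φ F : ℂ → ℂ} (hF : Continuous F) (hΦ : ∀ w, HasDerivAt Φ (F w) w)
    {a b C : ℝ} (hC : ∀ w : ℂ, 0 ≤ w.re → w.im ∈ Icc a b → ‖F w‖ ≤ C * Real.exp (-w.re))
    (hab : a ≤ b) : ∃ A, Tendsto Φ (stripEnd a b) (nhds A) := by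
  have hray : IntegrableOn (fun v : ℝ => F (v + a * Complex.I)) (Ioi 0) := by
    refine ((exp_neg_integrableOn_Ioi 0 one_pos).const_mul C).mono'
      (by fun_prop) ((ae_restrict_iff' measurableSet_Ioi).2 (ae_of_all _ fun v hv => ?_))
    have := hC (v + a * Complex.I) (by simpa using (le_of_lt hv)) (by simpa using hab)
    simpa using this
  have hA := tendsto_limUnder_of_hasDerivAt_of_integrableOn_Ioi
    (fun v _ => hasDerivAt_horizontal hΦ (a * Complex.I) v) hray
  refine ⟨limUnder atTop fun v : ℝ => Φ (v + a * Complex.I), ?_⟩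
  have h1 : Tendsto (fun w : ℂ => Φ (w.re + a * Complex.I)) (stripEnd a b)
      (nhds (limUnder atTop fun v : ℝ => Φ (v + a * Complex.I))) :=
    hA.comp (tendsto_comap.mono_left inf_le_left)
  have h2 : Tendsto (fun w : ℂ => C * Real.exp (-w.re) * (b - a)) (stripEnd a b) (nhds 0) := by
    have h3 : Tendsto (fun w : ℂ => Real.exp (-w.re)) (stripEnd a b) (nhds 0) :=
      Real.tendsto_exp_neg_atTop_nhds_zero.comp (tendsto_comap.mono_left inf_le_left)
    simpa using (h3.const_mul C).mul_const (b - a)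
  have h3 : Tendsto (fun w : ℂ => Φ w - Φ (w.re + a * Complex.I)) (stripEnd a b) (nhds 0) := by
    refine squeeze_zero_norm' ?_ h2
    have hev : ∀ᶠ w in stripEnd a b, 0 ≤ w.re ∧ w.im ∈ Icc a b := by
      refine Eventually.and ?_ ?_
      · exact (tendsto_comap.mono_left inf_le_left : Tendsto Complex.re (stripEnd a b) atTop).eventually
          (eventually_ge_atTop 0)
      · exact (mem_inf_of_right (mem_principal_self _) : _ ∈ stripEnd a b)
    filter_upwards [hev] with w hw
    have hconv : Convex ℝ ({w.re} ×ℂ Icc a b) :=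
      ((convex_singleton w.re).linear_preimage Complex.reLm).inter
        ((convex_Icc a b).linear_preimage Complex.imLm)
    have hb := hconv.norm_image_sub_le_of_norm_hasDerivWithin_le (f := Φ) (f' := F)
      (C := C * Real.exp (-w.re)) (x := w.re + a * Complex.I) (y := w)
      (fun z _ => (hΦ z).hasDerivWithinAt)
      (fun z hz => by
        have h4 := Complex.mem_reProdIm.1 hz
        have h5 : z.re = w.re := h4.1
        have := hC z (h5 ▸ hw.1) h4.2
        rwa [h5] at this)
      (Complex.mem_reProdIm.2 ⟨by simp, by simpa using hab⟩)
      (Complex.mem_reProdIm.2 ⟨by simp, hw.2⟩)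
    refine hb.trans (mul_le_mul_of_nonneg_left ?_ ((norm_nonneg _).trans (hC w hw.1 hw.2)))
    have h6 : w - (w.re + a * Complex.I) = ((w.im - a : ℝ) : ℂ) * Complex.I := by
      apply Complex.ext <;> simp
    rw [h6, norm_mul, Complex.norm_I, mul_one, Complex.norm_real, Real.norm_eq_abs,
      abs_of_nonneg (by linarith [hw.2.1])]
    linarith [hw.2.2]
  simpa using h3.add h1

/-- `J` is the integral of the entire function `F` along a path from the right end of the strip
`-π ≤ Im w ≤ -φ` to the right end of the strip `φ ≤ Im w ≤ π`. -/
def HasStripIntegral (φ : ℝ) (F : ℂ → ℂ) (J : ℂ) : Prop :=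
  ∃ (Φ : ℂ → ℂ) (A B : ℂ), (∀ w, HasDerivAt Φ (F w) w) ∧ Tendsto Φ (stripEnd φ Real.pi) (nhds A) ∧
    Tendsto Φ (stripEnd (-Real.pi) (-φ)) (nhds B) ∧ J = A - B

namespace HasStripIntegral

variable {φ : ℝ} {F G : ℂ → ℂ} {J K : ℂ}

theorem exists_of_bound (hφ : φ ≤ Real.pi) (hF : Differentiable ℂ F) {C : ℝ}
    (hC : ∀ w : ℂ, 0 ≤ w.re → |w.im| ∈ Icc φ Real.pi → ‖F w‖ ≤ C * Real.exp (-w.re))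
    (hφ0 : 0 ≤ φ) : ∃ J, HasStripIntegral φ F J := by
  obtain ⟨Φ, hΦ⟩ := hF.isExactOn_univ
  have hΦ : ∀ w, HasDerivAt Φ (F w) w := fun w => hΦ w (mem_univ w)
  obtain ⟨A, hA⟩ := exists_tendsto_stripEnd (a := φ) (b := Real.pi) hF.continuous hΦ
    (fun w h1 h2 => hC w h1 (by rwa [abs_of_nonneg (hφ0.trans h2.1)])) hφ
  obtain ⟨B, hB⟩ := exists_tendsto_stripEnd (a := -Real.pi) (b := -φ) hF.continuous hΦ
    (fun w h1 h2 => hC w h1 (by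
      rw [abs_of_nonpos (by linarith [h2.2])]
      exact ⟨by linarith [h2.2], by linarith [h2.1]⟩)) (by linarith)
  exact ⟨_, Φ, A, B, hΦ, hA, hB, rfl⟩

/-- Two primitives differ by a constant, which cancels in A - B; this takes the place of deforming
contours. -/
theorem unique (hφ : φ ≤ Real.pi) (h : HasStripIntegral φ F J) (h' : HasStripIntegral φ F K) :
    J = K := by
  obtain ⟨Φ, A, B, hΦ, hA, hB, rfl⟩ := h
  obtain ⟨Ψ, A', B', hΨ, hA', hB', rfl⟩ := h'
  have h1 : ∀ w, Φ w - Ψ w = Φ 0 - Ψ 0 := fun w => by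
    refine is_const_of_deriv_eq_zero (f := fun w => Φ w - Ψ w)
      (fun w => ((hΦ w).sub (hΨ w)).differentiableAt) (fun w => ?_) w 0
    exact (((hΦ w).sub (hΨ w)).deriv).trans (sub_self _)
  have := stripEnd_neBot hφ
  have : (stripEnd (-Real.pi) (-φ)).NeBot := stripEnd_neBot (by linarith)
  have h2 := tendsto_nhds_unique ((hA.sub hA').congr h1) tendsto_const_nhds
  have h3 := tendsto_nhds_unique ((hB.sub hB').congr h1) tendsto_const_nhds
  linear_combination h2 - h3

theorem add (h : HasStripIntegral φ F J) (h' : HasStripIntegral φ G K) :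
    HasStripIntegral φ (fun w => F w + G w) (J + K) := by
  obtain ⟨Φ, A, B, hΦ, hA, hB, rfl⟩ := h
  obtain ⟨Ψ, A', B', hΨ, hA', hB', rfl⟩ := h'
  exact ⟨_, _, _, fun w => (hΦ w).add (hΨ w), hA.add hA', hB.add hB', by ring⟩

theorem const_mul (c : ℂ) (h : HasStripIntegral φ F J) :
    HasStripIntegral φ (fun w => c * F w) (c * J) := by
  obtain ⟨Φ, A, B, hΦ, hA, hB, rfl⟩ := h
  exact ⟨_, _, _, fun w => (hΦ w).const_mul c, hA.const_mul c, hB.const_mul c, by ring⟩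

theorem of_hasDerivAt {Φ : ℂ → ℂ} (hΦ : ∀ w, HasDerivAt Φ (F w) w)
    (hA : Tendsto Φ (stripEnd φ Real.pi) (nhds 0))
    (hB : Tendsto Φ (stripEnd (-Real.pi) (-φ)) (nhds 0)) : HasStripIntegral φ F 0 :=
  ⟨Φ, 0, 0, hΦ, hA, hB, (sub_zero _).symm⟩

/-- Conjugation exchanges the two strips and thereby reverses the path. So the integral is purely
imaginary when `F` commutes with conjugation. -/
theorem neg_conj_eq (hφ : φ ≤ Real.pi) (h : HasStripIntegral φ F J)
    (hF : ∀ w, F (starRingEnd ℂ w) = starRingEnd ℂ (F w)) : -starRingEnd ℂ J = J := by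
  refine unique hφ ?_ h
  obtain ⟨Φ, A, B, hΦ, hA, hB, rfl⟩ := h
  have hre : ∀ a b : ℝ, Tendsto Complex.re (stripEnd a b) atTop :=
    fun a b => tendsto_comap.mono_left inf_le_left
  have him : ∀ a b : ℝ, ∀ᶠ w in stripEnd a b, w.im ∈ Icc a b :=
    fun a b => (mem_inf_of_right (mem_principal_self _) : _ ∈ stripEnd a b)
  refine ⟨fun w => starRingEnd ℂ (Φ (starRingEnd ℂ w)), starRingEnd ℂ B, starRingEnd ℂ A,
    fun w => ?_, ?_, ?_, by simp⟩
  · have h1 := (hΦ (starRingEnd ℂ w)).conj_conj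
    rw [hF, Complex.conj_conj, Complex.conj_conj] at h1
    exact h1
  · refine (Complex.continuous_conj.tendsto B).comp (hB.comp (tendsto_stripEnd ?_ ?_))
    · simpa using hre _ _
    · filter_upwards [him φ Real.pi] with w hw
      rw [Complex.conj_im]
      exact ⟨by linarith [hw.2], by linarith [hw.1]⟩
  · refine (Complex.continuous_conj.tendsto A).comp (hA.comp (tendsto_stripEnd ?_ ?_))
    · simpa using hre _ _
    · filter_upwards [him (-Real.pi) (-φ)] with w hw
      rw [Complex.conj_im]
      exact ⟨by linarith [hw.2], by linarith [hw.1]⟩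

/-- Evaluation along two horizontal rays and a vertical segment. -/
theorem eq_rays (h : HasStripIntegral φ F J) (hF : Continuous F) {ψ : ℝ}
    (hψ : ψ ∈ Icc φ Real.pi) (c : ℝ)
    (h1 : IntegrableOn (fun v : ℝ => F (v + ψ * Complex.I)) (Ioi c))
    (h2 : IntegrableOn (fun v : ℝ => F (v + (-ψ : ℝ) * Complex.I)) (Ioi c)) :
    J = (∫ v in Ioi c, F (v + ψ * Complex.I)) - (∫ v in Ioi c, F (v + (-ψ : ℝ) * Complex.I)) +
      ∫ θ in (-ψ)..ψ, F (c + θ * Complex.I) * Complex.I := by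
  obtain ⟨Φ, A, B, hΦ, hA, hB, rfl⟩ := h
  rw [integral_Ioi_of_hasDerivAt_of_tendsto' (fun v _ => hasDerivAt_horizontal hΦ _ v) h1
      (hA.comp (tendsto_ray_stripEnd hψ)),
    integral_Ioi_of_hasDerivAt_of_tendsto' (fun v _ => hasDerivAt_horizontal hΦ _ v) h2
      (hB.comp (tendsto_ray_stripEnd ⟨by linarith [hψ.2], by linarith [hψ.1]⟩)),
    intervalIntegral.integral_eq_sub_of_hasDerivAt (f := fun θ : ℝ => Φ (c + θ * Complex.I))]
  · ring
  · intro θ _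
    have h : HasDerivAt (fun θ : ℝ => (c + θ * Complex.I : ℂ)) Complex.I θ := by
      simpa using ((Complex.ofRealCLM.hasDerivAt (x := θ)).mul_const Complex.I).const_add (c : ℂ)
    exact HasDerivAt.comp_of_eq θ (hΦ _) h rfl
  · exact Continuous.intervalIntegrable (by fun_prop) _ _

end HasStripIntegral

/-! ### The Hankel contour in the logarithmic coordinate -/

theorem neg_ray_mem_slitPlane {ε : ℝ} (hε : ε ≠ 0) (u : ℝ) :
    -(u + ε * Complex.I : ℂ) ∈ Complex.slitPlane :=
  Or.inr (by simpa using hε)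

/-- Far out on a horizontal ray the direction of -t approaches the negative real axis, so the cosine
of its argument falls below cos φ. -/
theorem eventually_abs_arg_neg_ray (ε : ℝ) {φ : ℝ} (hφ0 : 0 ≤ φ) (hφ : φ < Real.pi) :
    ∀ᶠ u : ℝ in atTop, |(-(u + ε * Complex.I : ℂ)).arg| ∈ Icc φ Real.pi := by
  have hcos : -1 < Real.cos φ := by
    rw [← Real.cos_pi]
    exact Real.cos_lt_cos_of_nonneg_of_le_pi hφ0 le_rfl hφ
  have hlim : Tendsto (fun u : ℝ => |ε| / (u + |ε|) - 1) atTop (nhds (0 - 1)) :=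
    (tendsto_const_nhds.div_atTop (tendsto_id.atTop_add tendsto_const_nhds)).sub_const 1
  rw [zero_sub] at hlim
  filter_upwards [hlim.eventually (gt_mem_nhds hcos), eventually_gt_atTop 0] with u hu hu0
  set z : ℂ := -(u + ε * Complex.I) with hz
  have hzre : z.re = -u := by simp [hz]
  have hz0 : z ≠ 0 := fun h => by rw [h, Complex.zero_re] at hzre; linarith
  have hnorm : ‖z‖ ≤ u + |ε| := by
    rw [hz, norm_neg]
    refine (norm_add_le _ _).trans ?_
    simp [abs_of_pos hu0]
  refine ⟨?_, Complex.abs_arg_le_pi z⟩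
  by_contra! hlt
  have h1 := Real.cos_lt_cos_of_nonneg_of_le_pi (abs_nonneg z.arg) hφ.le hlt
  rw [Real.cos_abs, Complex.cos_arg hz0, hzre] at h1
  have h2 : -u / ‖z‖ ≤ |ε| / (u + |ε|) - 1 := by
    have h3 : 0 < u + |ε| := by positivity
    rw [div_sub_one h3.ne', div_le_div_iff₀ (norm_pos_iff.2 hz0) h3]
    nlinarith
  linarith

theorem tendsto_log_norm_ray (ε : ℝ) :
    Tendsto (fun u : ℝ => (Complex.log (-(u + ε * Complex.I : ℂ))).re) atTop atTop := by
  simp only [Complex.log_re, norm_neg]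
  refine Real.tendsto_log_atTop.comp (tendsto_atTop_mono (fun u => ?_) tendsto_id)
  have h := Complex.re_le_norm (u + ε * Complex.I)
  simpa using h

/-- Below the real axis -t lies in the upper half-plane, so the lower Hankel ray belongs to the
upper strip. -/
theorem tendsto_log_neg_ray_of_neg {ε : ℝ} (hε : ε < 0) {φ : ℝ} (hφ0 : 0 ≤ φ)
    (hφ : φ < Real.pi) : Tendsto (fun u : ℝ => Complex.log (-(u + ε * Complex.I : ℂ))) atTop
      (stripEnd φ Real.pi) := by
  refine tendsto_stripEnd (tendsto_log_norm_ray ε) ?_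
  filter_upwards [eventually_abs_arg_neg_ray ε hφ0 hφ] with u hu
  rw [Complex.log_im]
  rwa [abs_of_nonneg (Complex.arg_nonneg_iff.2 (by simpa using hε.le))] at hu

theorem tendsto_log_neg_ray_of_pos {ε : ℝ} (hε : 0 < ε) {φ : ℝ} (hφ0 : 0 ≤ φ)
    (hφ : φ < Real.pi) : Tendsto (fun u : ℝ => Complex.log (-(u + ε * Complex.I : ℂ))) atTop
      (stripEnd (-Real.pi) (-φ)) := by
  refine tendsto_stripEnd (tendsto_log_norm_ray ε) ?_
  filter_upwards [eventually_abs_arg_neg_ray ε hφ0 hφ] with u hu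
  rw [Complex.log_im]
  rw [abs_of_neg (Complex.arg_neg_iff.2 (by simpa using hε))] at hu
  exact ⟨by linarith [hu.2], by linarith [hu.1]⟩

/-- The bound C e^{-Re w} reads C/|t| for w = log(-t), and the factor 1/t from dw = dt/t improves it
to an integrable u^{-2}. The bounded part of the ray is covered by continuity. -/
theorem integrableOn_ray {F f : ℂ → ℂ} (hF : Continuous F) {φ C : ℝ} (hφ0 : 0 ≤ φ)
    (hφ : φ < Real.pi)
    (hC : ∀ w : ℂ, 0 ≤ w.re → |w.im| ∈ Icc φ Real.pi → ‖F w‖ ≤ C * Real.exp (-w.re))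
    (hf : ∀ t : ℂ, -t ∈ Complex.slitPlane → f t = -F (Complex.log (-t)) / t) {ε : ℝ}
    (hε : ε ≠ 0) : IntegrableOn (fun u : ℝ => f (u + ε * Complex.I)) (Ioi 0) := by
  have hcont : Continuous fun u : ℝ => f (u + ε * Complex.I) := by
    have h0 : ∀ u : ℝ, (u + ε * Complex.I : ℂ) ≠ 0 := fun u h =>
      Complex.slitPlane_ne_zero (neg_ray_mem_slitPlane hε u) (by rw [h, neg_zero])
    have h1 : Continuous fun u : ℝ => -F (Complex.log (-(u + ε * Complex.I))) /
        (u + ε * Complex.I : ℂ) := by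
      refine Continuous.div (hF.comp (Continuous.clog (by fun_prop)
        (neg_ray_mem_slitPlane hε))).neg (by fun_prop) h0
    exact h1.congr fun u => (hf _ (neg_ray_mem_slitPlane hε u)).symm
  obtain ⟨U, hU⟩ := eventually_atTop.1 ((eventually_abs_arg_neg_ray ε hφ0 hφ).and
    (eventually_ge_atTop 1))
  have hU0 : 0 < max U 1 := lt_max_of_lt_right one_pos
  rw [← Ioc_union_Ioi_eq_Ioi hU0.le]
  refine IntegrableOn.union ((hcont.integrableOn_Icc).mono_set Ioc_subset_Icc_self) ?_
  refine ((integrableOn_Ioi_rpow_of_lt (a := -2) (by norm_num) hU0).const_mul C).mono'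
    hcont.aestronglyMeasurable ((ae_restrict_iff' measurableSet_Ioi).2 (ae_of_all _ fun u hu => ?_))
  have hu : max U 1 < u := hu
  obtain ⟨h1, h2⟩ := hU u ((le_max_left _ _).trans hu.le)
  have hun : u ≤ ‖(u + ε * Complex.I : ℂ)‖ := by
    have h := Complex.re_le_norm (u + ε * Complex.I)
    simpa using h
  have hpos : 0 < ‖(u + ε * Complex.I : ℂ)‖ := by linarith
  have h3 := hC (Complex.log (-(u + ε * Complex.I)))
    (by rw [Complex.log_re, norm_neg]; exact Real.log_nonneg (by linarith))
    (by rwa [Complex.log_im])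
  rw [Complex.log_re, norm_neg, Real.exp_neg, Real.exp_log hpos] at h3
  have hC0 : 0 ≤ C := by
    have := (norm_nonneg _).trans h3
    exact nonneg_of_mul_nonneg_left this (inv_pos.2 hpos)
  rw [hf _ (neg_ray_mem_slitPlane hε u), norm_div, norm_neg,
    Real.rpow_neg (by linarith), Real.rpow_two, div_le_iff₀ hpos]
  refine h3.trans ?_
  rw [mul_assoc]
  refine mul_le_mul_of_nonneg_left ?_ hC0
  rw [← sub_nonneg]
  have h5 : 0 < u := by linarith
  have : (u ^ 2)⁻¹ * ‖(u + ε * Complex.I : ℂ)‖ - ‖(u + ε * Complex.I : ℂ)‖⁻¹ =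
      (‖(u + ε * Complex.I : ℂ)‖ ^ 2 - u ^ 2) / (u ^ 2 * ‖(u + ε * Complex.I : ℂ)‖) := by
    field_simp
  rw [this]
  refine div_nonneg ?_ (by positivity)
  nlinarith

theorem neg_hankelArc_mem_slitPlane {δ θ : ℝ} (hδ : 0 < δ) (hθ : θ ∈ Icc 0 Real.pi) :
    -hankelArc δ θ ∈ Complex.slitPlane := by
  have h : -hankelArc δ θ = (δ * Real.sin θ : ℝ) + (δ * Real.cos θ : ℝ) * Complex.I := by
    rw [hankelArc, ← neg_mul (θ : ℂ), ← Complex.ofReal_neg, Complex.exp_mul_I,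
      ← Complex.ofReal_cos, ← Complex.ofReal_sin, Real.cos_neg, Real.sin_neg]
    push_cast
    linear_combination (-δ * Complex.sin θ) * Complex.I_sq
  rw [h, Complex.mem_slitPlane_iff]
  simp only [Complex.add_re, Complex.ofReal_re, Complex.mul_re, Complex.I_re, mul_zero,
    Complex.ofReal_im, Complex.I_im, sub_self, add_zero, Complex.add_im, Complex.mul_im, mul_one,
    zero_add]
  rcases (Real.sin_nonneg_of_mem_Icc hθ).eq_or_lt with h0 | h0
  · right
    have h1 := Real.sin_sq_add_cos_sq θ
    rw [← h0] at h1
    have : Real.cos θ ≠ 0 := fun h2 => by rw [h2] at h1; norm_num at h1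
    exact mul_ne_zero hδ.ne' this
  · exact Or.inl (mul_pos hδ h0)

theorem hasDerivAt_hankelArc (δ θ : ℝ) :
    HasDerivAt (hankelArc δ) (-(δ * Complex.I) * (Complex.exp (-(θ * Complex.I)) * -Complex.I)) θ := by
  have h : HasDerivAt (fun θ : ℝ => (-(θ * Complex.I) : ℂ)) (-Complex.I) θ := by
    simpa using ((Complex.ofRealCLM.hasDerivAt (x := θ)).mul_const Complex.I).fun_neg
  exact (h.cexp).const_mul _

/-- The integral along the Hankel contour in the logarithmic coordinate. -/
theorem HasStripIntegral.hankel {F f : ℂ → ℂ} {J : ℂ} {φ C δ : ℝ} (h : HasStripIntegral φ F J)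
    (hF : Continuous F) (hφ0 : 0 ≤ φ) (hφ : φ < Real.pi)
    (hC : ∀ w : ℂ, 0 ≤ w.re → |w.im| ∈ Icc φ Real.pi → ‖F w‖ ≤ C * Real.exp (-w.re))
    (hf : ∀ t : ℂ, -t ∈ Complex.slitPlane → f t = -F (Complex.log (-t)) / t) (hδ : 0 < δ) :
    HankelIntegrable δ f ∧ hankelIntegral δ f = J := by
  have hlow : ∀ u, hankelLower δ u = u + (-δ : ℝ) * Complex.I := fun u => by
    rw [hankelLower]; push_cast; ring
  have hupp : ∀ u, hankelUpper δ u = u + δ * Complex.I := fun u => rfl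
  have hi1 : IntegrableOn (fun u : ℝ => f (hankelLower δ u)) (Ioi 0) := by
    simp only [hlow]
    exact integrableOn_ray hF hφ0 hφ hC hf (neg_ne_zero.2 hδ.ne')
  have hi3 : IntegrableOn (fun u : ℝ => f (hankelUpper δ u)) (Ioi 0) := by
    simp only [hupp]
    exact integrableOn_ray hF hφ0 hφ hC hf hδ.ne'
  have hi2 : IntervalIntegrable (fun θ : ℝ => f (hankelArc δ θ) * deriv (hankelArc δ) θ) volume 0
      Real.pi := by
    have harc : Continuous (hankelArc δ) :=
      continuous_iff_continuousAt.2 fun θ => (hasDerivAt_hankelArc δ θ).continuousAt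
    have hd : deriv (hankelArc δ) = fun θ : ℝ =>
        -(δ * Complex.I) * (Complex.exp (-(θ * Complex.I)) * -Complex.I) :=
      funext fun θ => (hasDerivAt_hankelArc δ θ).deriv
    rw [hd]
    refine ContinuousOn.intervalIntegrable (ContinuousOn.mul ?_ (by fun_prop))
    rw [uIcc_of_le Real.pi_pos.le]
    have hsl := fun θ (hθ : θ ∈ Icc 0 Real.pi) => neg_hankelArc_mem_slitPlane hδ hθ
    refine ContinuousOn.congr (f := fun θ => -F (Complex.log (-hankelArc δ θ)) / hankelArc δ θ) ?_
      fun θ hθ => hf _ (hsl θ hθ)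
    refine ContinuousOn.div (hF.comp_continuousOn
      (ContinuousOn.clog harc.neg.continuousOn hsl)).neg harc.continuousOn fun θ hθ h0 => ?_
    exact Complex.slitPlane_ne_zero (hsl θ hθ) (by rw [h0, neg_zero])
  refine ⟨⟨hi1, hi2, hi3⟩, ?_⟩
  obtain ⟨Φ, A, B, hΦ, hA, hB, rfl⟩ := h
  -- A primitive of `f` off the cut. Its minus sign reflects the orientation: the Hankel contour
  -- starts where Φ → A and ends where Φ → B.
  have hd : ∀ t : ℂ, -t ∈ Complex.slitPlane →
      HasDerivAt (fun t => -Φ (Complex.log (-t))) (f t) t := fun t ht => by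
    have h1 := ((hΦ _).comp t ((hasDerivAt_neg t).clog ht)).neg
    refine h1.congr_deriv ?_
    have ht0 : t ≠ 0 := fun h0 => Complex.slitPlane_ne_zero ht (by rw [h0, neg_zero])
    rw [hf t ht]
    field_simp
  have hray : ∀ ε : ℝ, ε ≠ 0 → ∀ u : ℝ, HasDerivAt
      (fun u : ℝ => -Φ (Complex.log (-(u + ε * Complex.I)))) (f (u + ε * Complex.I)) u :=
    fun ε hε u => by
      have h1 : HasDerivAt (fun u : ℝ => (u + ε * Complex.I : ℂ)) 1 u := by
        simpa using (Complex.ofRealCLM.hasDerivAt (x := u)).add_const (ε * Complex.I)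
      exact (HasDerivAt.comp_of_eq u (hd _ (neg_ray_mem_slitPlane hε u)) h1 rfl).congr_deriv
        (mul_one _)
  have e1 : ∫ u in Ioi (0 : ℝ), f (hankelLower δ u) = -A - -Φ (Complex.log (δ * Complex.I)) := by
    simp only [hlow] at hi1 ⊢
    rw [integral_Ioi_of_hasDerivAt_of_tendsto' (fun u _ => hray (-δ) (neg_ne_zero.2 hδ.ne') u) hi1
      (hA.comp (tendsto_log_neg_ray_of_neg (neg_lt_zero.2 hδ) hφ0 hφ)).neg]
    simp
  have e3 : ∫ u in Ioi (0 : ℝ), f (hankelUpper δ u) = -B - -Φ (Complex.log (-(δ * Complex.I))) := by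
    simp only [hupp] at hi3 ⊢
    rw [integral_Ioi_of_hasDerivAt_of_tendsto' (fun u _ => hray δ hδ.ne' u) hi3
      (hB.comp (tendsto_log_neg_ray_of_pos hδ hφ0 hφ)).neg]
    simp
  have e2 : ∫ θ in (0 : ℝ)..Real.pi, f (hankelArc δ θ) * deriv (hankelArc δ) θ =
      -Φ (Complex.log (-(δ * Complex.I))) - -Φ (Complex.log (δ * Complex.I)) := by
    rw [intervalIntegral.integral_eq_sub_of_hasDerivAt
      (f := fun θ : ℝ => -Φ (Complex.log (-hankelArc δ θ))) (fun θ hθ => ?_) hi2]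
    · simp [hankelArc, Complex.exp_neg, Complex.exp_pi_mul_I]
    · rw [uIcc_of_le Real.pi_pos.le] at hθ
      have h1 := HasDerivAt.comp_of_eq θ (hd _ (neg_hankelArc_mem_slitPlane hδ hθ))
        (hasDerivAt_hankelArc δ θ).differentiableAt.hasDerivAt rfl
      exact h1
  rw [hankelIntegral, e1, e2, e3]
  ring

/-! ### The integrands and Hankel's formula for 1/Γ -/

/-- The Hankel integrands in the logarithmic coordinate `w = log s`. -/
noncomputable def hankelFun (α x β : ℝ) (w : ℂ) : ℂ :=
  Complex.exp (Complex.exp w - x * Complex.exp (α * w) + β * w)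

theorem differentiable_hankelFun (α x β : ℝ) : Differentiable ℂ (hankelFun α x β) := by
  unfold hankelFun
  fun_prop

theorem hankelFun_conj (α x β : ℝ) (w : ℂ) :
    hankelFun α x β (starRingEnd ℂ w) = starRingEnd ℂ (hankelFun α x β w) := by
  simp [hankelFun, ← Complex.exp_conj]

theorem norm_hankelFun (α x β : ℝ) (w : ℂ) :
    ‖hankelFun α x β w‖ = Real.exp (Real.exp w.re * Real.cos w.im -
      x * (Real.exp (α * w.re) * Real.cos (α * w.im)) + β * w.re) := by
  have h : (α * w : ℂ).re = α * w.re ∧ (α * w : ℂ).im = α * w.im := by simp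
  rw [hankelFun, Complex.norm_exp]
  congr 1
  simp [Complex.exp_re, h.1, h.2]

/-- As α < 1, the term -κ e^v outweighs the others beyond some V; on [0, V] the exponent is bounded
by compactness. -/
theorem exists_bound_exp_exp {α κ : ℝ} (hα : α < 1) (hκ : 0 < κ) (a b : ℝ) :
    ∃ C : ℝ, ∀ v : ℝ, 0 ≤ v →
      Real.exp (-κ * Real.exp v + a * Real.exp (α * v) + b * v) ≤ C * Real.exp (-v) := by
  have hlim : Tendsto (fun v : ℝ => a * Real.exp (-((1 - α) * v)) + (b + 1) * (v * Real.exp (-v)))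
      atTop (nhds 0) := by
    have h1 : Tendsto (fun v : ℝ => Real.exp (-((1 - α) * v))) atTop (nhds 0) :=
      Real.tendsto_exp_neg_atTop_nhds_zero.comp (tendsto_id.const_mul_atTop (by linarith))
    have h2 := Real.tendsto_pow_mul_exp_neg_atTop_nhds_zero 1
    simp only [pow_one] at h2
    simpa using (h1.const_mul a).add (h2.const_mul (b + 1))
  obtain ⟨V, hV⟩ := eventually_atTop.1 (hlim.eventually (gt_mem_nhds hκ))
  obtain ⟨M, hM⟩ := (isCompact_Icc (a := (0 : ℝ)) (b := V)).exists_bound_of_continuousOn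
    (f := fun v : ℝ => -κ * Real.exp v + a * Real.exp (α * v) + (b + 1) * v)
    (by fun_prop)
  refine ⟨Real.exp (max M 0), fun v hv => ?_⟩
  rw [← Real.exp_add, Real.exp_le_exp]
  suffices h : -κ * Real.exp v + a * Real.exp (α * v) + (b + 1) * v ≤ max M 0 by linarith
  rcases le_total v V with hvV | hvV
  · exact ((le_abs_self _).trans (hM v ⟨hv, hvV⟩)).trans (le_max_left _ _)
  · refine le_trans ?_ (le_max_right M 0)
    have h1 := hV v hvV
    have h2 : Real.exp (α * v) = Real.exp v * Real.exp (-((1 - α) * v)) := by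
      rw [← Real.exp_add]; ring_nf
    have h3 : v = Real.exp v * (v * Real.exp (-v)) := by
      rw [mul_left_comm, ← Real.exp_add]; simp
    have h4 : -κ * Real.exp v + a * Real.exp (α * v) + (b + 1) * v = Real.exp v *
        (a * Real.exp (-((1 - α) * v)) + (b + 1) * (v * Real.exp (-v)) - κ) := by
      rw [h2]
      linear_combination (b + 1) * h3
    rw [h4]
    exact mul_nonpos_of_nonneg_of_nonpos (Real.exp_pos v).le (by linarith)

theorem cos_le_of_abs_mem {φ y : ℝ} (hφ0 : 0 ≤ φ) (hy : |y| ∈ Icc φ Real.pi) :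
    Real.cos y ≤ Real.cos φ := by
  rw [← Real.cos_abs y]
  exact Real.cos_le_cos_of_nonneg_of_le_pi hφ0 hy.2 hy.1

/-- Since φ > π/2, cos(Im w) ≤ cos φ < 0 on both strips, and exp(e^w) decays doubly exponentially;
the term with x has lower order, whatever its sign. -/
theorem exists_bound_hankelFun {α φ : ℝ} (hα : α < 1) (hφ : φ ∈ Ioc (Real.pi / 2) Real.pi)
    (x β : ℝ) : ∃ C : ℝ, ∀ w : ℂ, 0 ≤ w.re → |w.im| ∈ Icc φ Real.pi →
      ‖hankelFun α x β w‖ ≤ C * Real.exp (-w.re) := by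
  have hφ0 : 0 ≤ φ := (Real.pi_div_two_pos.trans hφ.1).le
  have hκ : 0 < -Real.cos φ := by
    have := Real.cos_neg_of_pi_div_two_lt_of_lt hφ.1 (by linarith [hφ.2, Real.pi_pos])
    linarith
  obtain ⟨C, hC⟩ := exists_bound_exp_exp hα hκ |x| β
  refine ⟨C, fun w hw him => le_trans ?_ (hC w.re hw)⟩
  rw [norm_hankelFun, Real.exp_le_exp]
  have h1 := mul_le_mul_of_nonneg_left (cos_le_of_abs_mem hφ0 him) (Real.exp_pos w.re).le
  have h2 : -(x * (Real.exp (α * w.re) * Real.cos (α * w.im))) ≤ |x| * Real.exp (α * w.re) := by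
    refine (neg_le_abs _).trans ?_
    rw [abs_mul, abs_mul, abs_of_pos (Real.exp_pos _)]
    refine mul_le_mul_of_nonneg_left ?_ (abs_nonneg x)
    exact mul_le_of_le_one_right (Real.exp_pos _).le (Real.abs_cos_le_one _)
  linarith

theorem exists_hasStripIntegral_hankelFun {α φ : ℝ} (hα : α < 1)
    (hφ : φ ∈ Ioc (Real.pi / 2) Real.pi) (x β : ℝ) :
    ∃ J, HasStripIntegral φ (hankelFun α x β) J := by
  obtain ⟨C, hC⟩ := exists_bound_hankelFun hα hφ x β
  exact HasStripIntegral.exists_of_bound hφ.2 (differentiable_hankelFun α x β) hC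
    (Real.pi_div_two_pos.trans hφ.1).le

theorem integrableOn_ray_hankelFun {α φ : ℝ} (hα : α < 1) (hφ : φ ∈ Ioc (Real.pi / 2) Real.pi)
    (x β : ℝ) {ψ : ℝ} (hψ : |ψ| ∈ Icc φ Real.pi) (c : ℝ) :
    IntegrableOn (fun v : ℝ => hankelFun α x β (v + ψ * Complex.I)) (Ioi c) := by
  obtain ⟨C, hC⟩ := exists_bound_hankelFun hα hφ x β
  have hcont : Continuous fun v : ℝ => hankelFun α x β (v + ψ * Complex.I) :=
    (differentiable_hankelFun α x β).continuous.comp (by fun_prop)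
  have h0 : IntegrableOn (fun v : ℝ => hankelFun α x β (v + ψ * Complex.I)) (Ioi 0) := by
    refine ((exp_neg_integrableOn_Ioi 0 one_pos).const_mul C).mono'
      hcont.aestronglyMeasurable ((ae_restrict_iff' measurableSet_Ioi).2
        (ae_of_all _ fun v hv => ?_))
    have := hC (v + ψ * Complex.I) (by simpa using (le_of_lt hv)) (by simpa using hψ)
    simpa using this
  refine ((hcont.integrableOn_Icc (a := c) (b := 0)).union h0).mono_set fun v hv => ?_
  rcases le_or_gt v 0 with h | h
  · exact Or.inl ⟨le_of_lt hv, h⟩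
  · exact Or.inr h

theorem tendsto_hankelFun_stripEnd {α φ : ℝ} (hα : α < 1) (hφ : φ ∈ Ioc (Real.pi / 2) Real.pi)
    (x β a b : ℝ) (hab : ∀ y ∈ Icc a b, |y| ∈ Icc φ Real.pi) :
    Tendsto (hankelFun α x β) (stripEnd a b) (nhds 0) := by
  obtain ⟨C, hC⟩ := exists_bound_hankelFun hα hφ x β
  have hre : Tendsto Complex.re (stripEnd a b) atTop := tendsto_comap.mono_left inf_le_left
  have him : ∀ᶠ w in stripEnd a b, w.im ∈ Icc a b :=
    (mem_inf_of_right (mem_principal_self _) : _ ∈ stripEnd a b)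
  have hlim : Tendsto (fun w : ℂ => C * Real.exp (-w.re)) (stripEnd a b) (nhds 0) := by
    simpa using (Real.tendsto_exp_neg_atTop_nhds_zero.comp hre).const_mul C
  refine squeeze_zero_norm' ?_ hlim
  filter_upwards [hre.eventually (eventually_ge_atTop 0), him] with w h1 h2
  exact hC w h1 (hab _ h2)

/-- Integration by parts on the Hankel contour. -/
theorem HasStripIntegral.gamma_recurrence {φ β : ℝ} (hφ : φ ∈ Ioc (Real.pi / 2) Real.pi) {J : ℂ}
    (h : HasStripIntegral φ (hankelFun 0 0 β) J) :
    HasStripIntegral φ (hankelFun 0 0 (β + 1)) (-β * J) := by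
  have hd : ∀ w : ℂ, HasDerivAt (hankelFun 0 0 β)
      (hankelFun 0 0 (β + 1) w + β * hankelFun 0 0 β w) w := fun w => by
    have h1 : HasDerivAt (fun w : ℂ => Complex.exp w - (0 : ℝ) * Complex.exp ((0 : ℝ) * w) + β * w)
        (Complex.exp w - (0 : ℝ) * (Complex.exp ((0 : ℝ) * w) * ((0 : ℝ) * 1)) + β * 1) w :=
      (((Complex.hasDerivAt_exp w).sub ((((hasDerivAt_id w).const_mul _).cexp).const_mul _)).add
        ((hasDerivAt_id w).const_mul _))
    refine h1.cexp.congr_deriv ?_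
    simp only [hankelFun, Complex.ofReal_zero, zero_mul, sub_zero, mul_one, Complex.ofReal_add,
      Complex.ofReal_one, add_mul, one_mul]
    rw [← add_assoc, Complex.exp_add _ w]
    ring
  have hφ0 := Real.pi_div_two_pos.trans hφ.1
  have h0 : HasStripIntegral φ (fun w => hankelFun 0 0 (β + 1) w + β * hankelFun 0 0 β w) 0 :=
    .of_hasDerivAt hd
      (tendsto_hankelFun_stripEnd zero_lt_one hφ _ _ _ _ fun y hy => by
        rwa [abs_of_nonneg (hφ0.le.trans hy.1)])
      (tendsto_hankelFun_stripEnd zero_lt_one hφ _ _ _ _ fun y hy => by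
        rw [abs_of_nonpos (by linarith [hy.2])]
        exact ⟨by linarith [hy.2], by linarith [hy.1]⟩)
  have h2 := h0.add (h.const_mul (-β))
  rw [zero_add] at h2
  convert h2 using 2 with w
  ring

theorem hankelFun_zero_add_pi (β v : ℝ) : hankelFun 0 0 β (v + Real.pi * Complex.I) =
    (Real.exp (-Real.exp v + β * v) : ℂ) * Complex.exp (β * Real.pi * Complex.I) := by
  rw [hankelFun, Complex.exp_add v, Complex.exp_pi_mul_I]
  push_cast
  rw [← Complex.exp_add]
  congr 1
  ring

theorem hankelFun_zero_sub_pi (β v : ℝ) : hankelFun 0 0 β (v + (-Real.pi : ℝ) * Complex.I) =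
    (Real.exp (-Real.exp v + β * v) : ℂ) * Complex.exp (-(β * Real.pi) * Complex.I) := by
  have h : Complex.exp ((-Real.pi : ℝ) * Complex.I) = -1 := by
    push_cast
    rw [neg_mul, Complex.exp_neg, Complex.exp_pi_mul_I]
    norm_num
  rw [hankelFun, Complex.exp_add v, h]
  push_cast
  rw [← Complex.exp_add]
  congr 1
  ring

theorem hankelFun_zero_vertical (β c θ : ℝ) : hankelFun 0 0 β (c + θ * Complex.I) =
    (Real.exp (β * c) : ℂ) *
      (Complex.exp (Real.exp c * Complex.exp (θ * Complex.I) + β * θ * Complex.I)) := by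
  rw [hankelFun, Complex.exp_add c]
  push_cast
  rw [← Complex.exp_add (β * c)]
  congr 1
  ring

/-- The substitution y = e^v turns this into the Γ integral truncated at e^{-n}. -/
theorem tendsto_integral_exp_neg_exp {β : ℝ} (hβ : 0 < β) :
    Tendsto (fun n : ℕ => ∫ v in Ioi (-(n : ℝ)), Real.exp (-Real.exp v + β * v)) atTop
      (nhds (Real.Gamma β)) := by
  have h1 : ∀ n : ℕ, ∫ v in Ioi (-(n : ℝ)), Real.exp (-Real.exp v + β * v) =
      ∫ y in Ioi (Real.exp (-(n : ℝ))), Real.exp (-y) * y ^ (β - 1) := fun n => by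
    rw [← integral_comp_exp_Ioi]
    refine integral_congr_ae (ae_of_all _ fun v => ?_)
    simp only [smul_eq_mul]
    rw [← Real.exp_mul, ← Real.exp_add, ← Real.exp_add]
    ring_nf
  have hun : ⋃ n : ℕ, Ioi (Real.exp (-(n : ℝ))) = Ioi 0 := by
    ext y
    simp only [mem_iUnion, mem_Ioi]
    constructor
    · rintro ⟨n, hn⟩
      exact (Real.exp_pos _).trans hn
    · intro hy
      have h := (Real.tendsto_exp_neg_atTop_nhds_zero.comp
        (tendsto_natCast_atTop_atTop (R := ℝ))).eventually (gt_mem_nhds hy)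
      exact h.exists
  simp only [h1]
  rw [Real.Gamma_eq_integral hβ, ← hun]
  refine tendsto_setIntegral_of_monotone (fun n => measurableSet_Ioi) (fun m n hmn => ?_) ?_
  · refine Ioi_subset_Ioi (Real.exp_le_exp.2 (neg_le_neg (Nat.cast_le.2 hmn)))
  · rw [hun]
    exact Real.GammaIntegral_convergent hβ

/-- The segment at abscissa -n is the circle of radius e^{-n} in the coordinate e^w; the integral is
continuous in the radius, down to radius 0. -/
theorem tendsto_integral_vertical (β : ℝ) :
    Tendsto (fun n : ℕ => ∫ θ in (-Real.pi)..Real.pi, Complex.exp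
      (Real.exp (-(n : ℝ)) * Complex.exp (θ * Complex.I) + β * θ * Complex.I) * Complex.I) atTop
      (nhds (∫ θ in (-Real.pi)..Real.pi, Complex.exp (β * θ * Complex.I) * Complex.I)) := by
  have hcont : Continuous fun r : ℝ => ∫ θ in (-Real.pi)..Real.pi, Complex.exp
      (r * Complex.exp (θ * Complex.I) + β * θ * Complex.I) * Complex.I := by
    refine intervalIntegral.continuous_parametric_intervalIntegral_of_continuous' ?_ _ _
    simp only [Function.uncurry_def]
    fun_prop
  have h := (hcont.tendsto 0).comp (Real.tendsto_exp_neg_atTop_nhds_zero.comp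
    (tendsto_natCast_atTop_atTop (R := ℝ)))
  simpa [Function.comp_def] using h

/-- **Hankel's formula** for the reciprocal Gamma function, base case. -/
theorem HasStripIntegral.gamma_base {φ β : ℝ} (hφ : φ ∈ Ioc (Real.pi / 2) Real.pi)
    (hβ : β ∈ Ico (0 : ℝ) 1) {J : ℂ} (h : HasStripIntegral φ (hankelFun 0 0 β) J) :
    J = 2 * Real.pi * Complex.I / Real.Gamma (1 - β) := by
  have hpi : Real.pi ∈ Icc φ Real.pi := ⟨hφ.2, le_rfl⟩
  have habs : |Real.pi| ∈ Icc φ Real.pi := by rwa [abs_of_pos Real.pi_pos]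
  -- The keyhole contour: rays at heights ±π, where e^w = -e^v and the phases e^{±iβπ} combine to 2i
  -- sin(βπ), and a small circle.
  have hJ : ∀ n : ℕ, J = 2 * Complex.I * Real.sin (β * Real.pi) *
      (∫ v in Ioi (-(n : ℝ)), Real.exp (-Real.exp v + β * v) : ℝ) +
      (Real.exp (β * -(n : ℝ)) : ℂ) * ∫ θ in (-Real.pi)..Real.pi, Complex.exp
        (Real.exp (-(n : ℝ)) * Complex.exp (θ * Complex.I) + β * θ * Complex.I) * Complex.I :=
    fun n => by
      rw [h.eq_rays (differentiable_hankelFun 0 0 β).continuous hpi (-(n : ℝ))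
        (integrableOn_ray_hankelFun zero_lt_one hφ _ _ habs _)
        (integrableOn_ray_hankelFun zero_lt_one hφ _ _ (by rwa [abs_neg]) _)]
      simp only [hankelFun_zero_add_pi, hankelFun_zero_sub_pi]
      simp only [hankelFun_zero_vertical]
      rw [integral_mul_const, integral_mul_const, integral_complex_ofReal,
        ← intervalIntegral.integral_const_mul]
      simp only [mul_assoc]
      congr 1
      generalize ∫ v in Ioi (-(n : ℝ)), Real.exp (-Real.exp v + β * v) = G
      rw [← mul_sub, mul_comm]
      push_cast
      rw [Complex.sin]
      ring_nf
      rw [Complex.I_sq]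
      ring
  -- For β = 0 the sine vanishes and the circle contributes 2πi. For β > 0 the circle disappears in
  -- the limit and the reflection formula evaluates the rays.
  rcases hβ.1.eq_or_lt with h0 | h0
  · subst h0
    have hlim := tendsto_integral_vertical 0
    refine tendsto_nhds_unique (tendsto_const_nhds.congr fun n => ?_) (hlim.trans ?_)
    · have := hJ n
      simpa using this
    · simp
      ring_nf
  · have h1 : Tendsto (fun n : ℕ => (Real.exp (β * -(n : ℝ)) : ℂ)) atTop (nhds 0) := by
      have h2 : Tendsto (fun n : ℕ => Real.exp (-(β * (n : ℝ)))) atTop (nhds 0) :=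
        Real.tendsto_exp_neg_atTop_nhds_zero.comp
          ((tendsto_natCast_atTop_atTop (R := ℝ)).const_mul_atTop h0)
      have h3 := (Complex.continuous_ofReal.tendsto 0).comp h2
      simpa [Function.comp_def] using h3
    have h2 := (((Complex.continuous_ofReal.tendsto _).comp
      (tendsto_integral_exp_neg_exp h0)).const_mul (2 * Complex.I * Real.sin (β * Real.pi))).add
        (h1.mul (tendsto_integral_vertical β))
    have h3 := tendsto_nhds_unique (tendsto_const_nhds.congr hJ) h2
    rw [h3, zero_mul, add_zero]
    have h4 := Real.Gamma_mul_Gamma_one_sub β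
    have h5 : Real.Gamma (1 - β) ≠ 0 := (Real.Gamma_pos_of_pos (by linarith [hβ.2])).ne'
    have h6 : Real.sin (Real.pi * β) ≠ 0 := by
      refine (Real.sin_pos_of_pos_of_lt_pi (mul_pos Real.pi_pos h0) ?_).ne'
      nlinarith [hβ.2, Real.pi_pos]
    rw [eq_div_iff (Complex.ofReal_ne_zero.2 h5), mul_assoc, ← Complex.ofReal_mul, h4, mul_assoc,
      ← Complex.ofReal_mul, mul_comm β, mul_div_cancel₀ _ h6]
    ring

/-- **Hankel's formula** for the reciprocal Gamma function. -/
theorem HasStripIntegral.gamma {φ z : ℝ} (hφ : φ ∈ Ioc (Real.pi / 2) Real.pi) (hz : 0 < z) {J : ℂ}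
    (h : HasStripIntegral φ (hankelFun 0 0 (1 - z)) J) :
    J = 2 * Real.pi * Complex.I / Real.Gamma z := by
  obtain ⟨n, hn⟩ := exists_nat_ge z
  induction n generalizing z J with
  | zero => simp at hn; linarith
  | succ n ih =>
    -- On (0, 1] the base case applies with β = 1 - z; beyond, integration by parts lowers z by one,
    -- in step with Γ(z) = (z-1)Γ(z-1).
    by_cases hz1 : z ≤ 1
    · rw [h.gamma_base hφ ⟨by linarith, by linarith⟩, sub_sub_cancel]
    · push Not at hz1
      have hr := h.gamma_recurrence hφ
      rw [show 1 - z + 1 = 1 - (z - 1) by ring] at hr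
      have h1 := ih (by linarith) hr (by push_cast at hn; linarith)
      have hz0 : z - 1 ≠ 0 := by linarith
      have h2 : Real.Gamma z = (z - 1) * Real.Gamma (z - 1) := by
        rw [← Real.Gamma_add_one hz0, sub_add_cancel]
      have h3 : (Real.Gamma (z - 1) : ℂ) ≠ 0 :=
        Complex.ofReal_ne_zero.2 (Real.Gamma_pos_of_pos (by linarith)).ne'
      have h4 : ((z - 1 : ℝ) : ℂ) ≠ 0 := Complex.ofReal_ne_zero.2 hz0
      rw [h2, Complex.ofReal_mul]
      rw [eq_div_iff h3] at h1
      rw [eq_div_iff (mul_ne_zero h4 h3)]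
      push_cast at h1 ⊢
      linear_combination h1

/-! ### Laplace mixtures and their moments -/

/-- A mixture of the exponentials `x ↦ exp (-x a(τ))`. -/
noncomputable def laplaceMix (μ : Measure ℝ) (k a : ℝ → ℂ) (x : ℝ) : ℂ :=
  ∫ τ, k τ * Complex.exp (-(x * a τ)) ∂μ

/-- The weights are integrable and the exponents have real part at least `κ`. -/
structure IsLaplaceMix (μ : Measure ℝ) (k a : ℝ → ℂ) (κ : ℝ) : Prop where
  integrable : Integrable k μ
  continuous : Continuous a
  le_re : ∀ᵐ τ ∂μ, κ ≤ (a τ).re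

namespace IsLaplaceMix

variable {μ : Measure ℝ} {k a : ℝ → ℂ} {κ : ℝ}

theorem norm_integrand_le {x κ : ℝ} (hx : 0 ≤ x) {b c : ℂ} (hb : κ ≤ b.re) :
    ‖c * Complex.exp (-(x * b))‖ ≤ Real.exp (-κ * x) * ‖c‖ := by
  rw [norm_mul, Complex.norm_exp, mul_comm]
  refine mul_le_mul_of_nonneg_right (Real.exp_le_exp.2 ?_) (norm_nonneg _)
  simp
  nlinarith

theorem exists_norm_le (h : IsLaplaceMix μ k a κ) :
    ∃ B, 0 ≤ B ∧ ∀ x : ℝ, 0 ≤ x → ‖laplaceMix μ k a x‖ ≤ Real.exp (-κ * x) * B := by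
  refine ⟨∫ τ, ‖k τ‖ ∂μ, integral_nonneg fun _ => norm_nonneg _, fun x hx => ?_⟩
  rw [laplaceMix, ← integral_const_mul]
  exact norm_integral_le_of_norm_le (h.integrable.norm.const_mul _)
    (h.le_re.mono fun τ hτ => norm_integrand_le hx hτ)

theorem aestronglyMeasurable (h : IsLaplaceMix μ k a κ) (x : ℝ) :
    AEStronglyMeasurable (fun τ => k τ * Complex.exp (-(x * a τ))) μ :=
  h.integrable.aestronglyMeasurable.mul
    (by have := h.continuous; fun_prop : Continuous fun τ => Complex.exp (-(x * a τ))).aestronglyMeasurable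

theorem continuousOn (h : IsLaplaceMix μ k a κ) (hκ : 0 < κ) :
    ContinuousOn (laplaceMix μ k a) (Ioi 0) := by
  refine continuousOn_of_dominated (bound := fun τ => ‖k τ‖) (fun x _ => h.aestronglyMeasurable x)
    (fun x hx => h.le_re.mono fun τ hτ => ?_) h.integrable.norm
    (ae_of_all _ fun τ => by fun_prop)
  have hx : 0 < x := hx
  refine (norm_integrand_le hx.le hτ).trans (mul_le_of_le_one_left (norm_nonneg _) ?_)
  rw [Real.exp_le_one_iff]
  nlinarith

theorem norm_pow_mul_exp {x : ℝ} (hx : 0 ≤ x) (b : ℂ) (r : ℕ) :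
    ‖(x : ℂ) ^ r * Complex.exp (-(x * b))‖ = x ^ r * Real.exp (-b.re * x) := by
  rw [norm_mul, norm_pow, Complex.norm_real, Real.norm_eq_abs, abs_of_nonneg hx, Complex.norm_exp]
  simp [mul_comm]

theorem integrableOn_pow_mul_exp {b : ℂ} (hb : 0 < b.re) (r : ℕ) :
    IntegrableOn (fun x : ℝ => (x : ℂ) ^ r * Complex.exp (-(x * b))) (Ioi 0) :=
  (integrableOn_pow_mul_exp_neg hb r).mono' (by fun_prop) ((ae_restrict_iff' measurableSet_Ioi).2
    (ae_of_all _ fun _ hx => (norm_pow_mul_exp (le_of_lt hx) b r).le))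

theorem integral_pow_mul_exp {b : ℂ} (hb : 0 < b.re) (r : ℕ) :
    ∫ x in Ioi (0 : ℝ), (x : ℂ) ^ r * Complex.exp (-(x * b)) = r.factorial / b ^ (r + 1) := by
  have hb0 : b ≠ 0 := fun h => by simp [h] at hb
  induction r with
  | zero =>
    have h := integral_exp_mul_complex_Ioi (a := -b) (by simpa using hb) 0
    simp only [pow_zero, one_mul, zero_add, pow_one, Nat.factorial_zero, Nat.cast_one]
    simp only [Complex.ofReal_zero, mul_zero, Complex.exp_zero, neg_mul, neg_mul, neg_div, div_neg, neg_neg] at h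
    rw [← h]
    congr 1 with x
    rw [mul_comm]
  | succ r ih =>
    have hd : ∀ x : ℝ, HasDerivAt (fun x : ℝ => (x : ℂ) ^ (r + 1) * Complex.exp (-(x * b)))
        ((r + 1) * ((x : ℂ) ^ r * Complex.exp (-(x * b))) -
          b * ((x : ℂ) ^ (r + 1) * Complex.exp (-(x * b)))) x := fun x => by
      have h1 : HasDerivAt (fun x : ℝ => (x : ℂ)) 1 x := (hasDerivAt_id x).ofReal_comp
      refine ((h1.fun_pow (r + 1)).mul ((h1.mul_const b).fun_neg.cexp)).congr_deriv ?_
      simp only [Nat.add_sub_cancel]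
      push_cast
      ring
    have hlim : Tendsto (fun x : ℝ => (x : ℂ) ^ (r + 1) * Complex.exp (-(x * b))) atTop
        (nhds 0) := by
      have h2 := tendsto_rpow_mul_exp_neg_mul_atTop_nhds_zero (r + 1 : ℕ) b.re hb
      simp only [Real.rpow_natCast] at h2
      refine squeeze_zero_norm' ?_ h2
      filter_upwards [eventually_ge_atTop 0] with x hx
      exact (norm_pow_mul_exp hx b _).le
    have h3 := integral_Ioi_of_hasDerivAt_of_tendsto' (a := 0) (fun x _ => hd x)
      (((integrableOn_pow_mul_exp hb r).const_mul _).sub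
        ((integrableOn_pow_mul_exp hb (r + 1)).const_mul _)) hlim
    rw [integral_sub ((integrableOn_pow_mul_exp hb r).const_mul _)
      ((integrableOn_pow_mul_exp hb (r + 1)).const_mul _), integral_const_mul, integral_const_mul,
      ih] at h3
    simp only [Complex.ofReal_zero, zero_pow (Nat.succ_ne_zero r), zero_mul, sub_zero] at h3
    have h4 := sub_eq_zero.1 h3
    rw [Nat.factorial_succ]
    refine mul_left_cancel₀ hb0 ?_
    rw [← h4]
    push_cast
    field_simp
    ring

/-- Dominated by x^r e^{-κx} ‖k τ‖, a product of integrable functions; this permits Fubini for the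
moments. -/
theorem integrable_prod [SFinite μ] (h : IsLaplaceMix μ k a κ) (hκ : 0 < κ) (r : ℕ) :
    Integrable (fun z : ℝ × ℝ => (z.1 : ℂ) ^ r * (k z.2 * Complex.exp (-(z.1 * a z.2))))
      ((volume.restrict (Ioi 0)).prod μ) := by
  have h1 := (integrableOn_pow_mul_exp_neg hκ r).mul_prod h.integrable.norm
  have hk : AEStronglyMeasurable (fun z : ℝ × ℝ => k z.2) ((volume.restrict (Ioi 0)).prod μ) :=
    h.integrable.aestronglyMeasurable.comp_snd
  have hc : Continuous fun z : ℝ × ℝ => Complex.exp (-(z.1 * a z.2)) := by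
    have := h.continuous
    fun_prop
  have hp : Continuous fun z : ℝ × ℝ => (z.1 : ℂ) ^ r := by fun_prop
  refine h1.mono' (hp.aestronglyMeasurable.mul (hk.mul hc.aestronglyMeasurable)) ?_
  have e1 : ∀ᵐ z ∂((volume.restrict (Ioi (0 : ℝ))).prod μ), z.1 ∈ Ioi (0 : ℝ) :=
    Measure.quasiMeasurePreserving_fst.ae (ae_restrict_mem measurableSet_Ioi)
  have e2 : ∀ᵐ z ∂((volume.restrict (Ioi (0 : ℝ))).prod μ), κ ≤ (a z.2).re :=
    Measure.quasiMeasurePreserving_snd.ae h.le_re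
  filter_upwards [e1, e2] with z hz1 hz2
  have hz1 : 0 < z.1 := hz1
  rw [norm_mul, norm_pow, Complex.norm_real, Real.norm_eq_abs, abs_of_pos hz1, mul_assoc]
  exact mul_le_mul_of_nonneg_left (norm_integrand_le hz1.le hz2) (by positivity)

theorem integrableOn_pow_mul [SFinite μ] (h : IsLaplaceMix μ k a κ) (hκ : 0 < κ) (r : ℕ) :
    IntegrableOn (fun x : ℝ => (x : ℂ) ^ r * laplaceMix μ k a x) (Ioi 0) := by
  have := (h.integrable_prod hκ r).integral_prod_left
  simp only [integral_const_mul] at this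
  exact this

theorem integral_pow_mul [SFinite μ] (h : IsLaplaceMix μ k a κ) (hκ : 0 < κ) (r : ℕ) :
    ∫ x in Ioi (0 : ℝ), (x : ℂ) ^ r * laplaceMix μ k a x =
      r.factorial * ∫ τ, k τ / a τ ^ (r + 1) ∂μ := by
  simp only [laplaceMix, ← integral_const_mul]
  rw [integral_integral_swap (h.integrable_prod hκ r)]
  refine integral_congr_ae (h.le_re.mono fun τ hτ => ?_)
  simp only [mul_left_comm _ (k τ), integral_const_mul]
  rw [integral_pow_mul_exp (hκ.trans_le hτ)]
  ring

end IsLaplaceMix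

/-! ### The Mittag-Leffler density -/

theorem hankelFun_eq_mul_exp (α x β : ℝ) (w : ℂ) :
    hankelFun α x β w = hankelFun α 0 β w * Complex.exp (-(x * Complex.exp (α * w))) := by
  rw [hankelFun, hankelFun, ← Complex.exp_add]
  congr 1
  push_cast
  ring

/-- Integrating x^r e^{-xa} leaves 1/a^{r+1}, which merely shifts β; so the moments are again Hankel
integrals, now with x = 0. -/
theorem hankelFun_div_pow (α β : ℝ) (r : ℕ) (w : ℂ) :
    hankelFun α 0 β w / Complex.exp (α * w) ^ (r + 1) = hankelFun α 0 (β - (r + 1) * α) w := by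
  rw [hankelFun, hankelFun, ← Complex.exp_nat_mul, ← Complex.exp_sub]
  congr 1
  push_cast
  ring

/-- The half opening angle of the contours along which the moments are computed. -/
noncomputable def stripAngle (α : ℝ) : ℝ := Real.pi / (1 + α)

theorem stripAngle_mem {α : ℝ} (hα : α ∈ Ioo (0 : ℝ) 1) :
    stripAngle α ∈ Ioo (Real.pi / 2) Real.pi := by
  have := Real.pi_pos
  constructor
  · exact div_lt_div_of_pos_left this (by linarith [hα.1]) (by linarith [hα.2])
  · exact div_lt_self this (by linarith [hα.1])

theorem stripAngle_mem' {α : ℝ} (hα : α ∈ Ioo (0 : ℝ) 1) :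
    stripAngle α ∈ Ioc (Real.pi / 2) Real.pi := Ioo_subset_Ioc_self (stripAngle_mem hα)

theorem stripAngle_pos {α : ℝ} (hα : α ∈ Ioo (0 : ℝ) 1) : 0 < stripAngle α :=
  Real.pi_div_two_pos.trans (stripAngle_mem hα).1

/-- The second demand on the angle φ = π/(1+α): besides φ > π/2, which makes exp(e^w) decay, αφ <
π/2 keeps Re e^{αw} positive. -/
theorem cos_mul_stripAngle_pos {α : ℝ} (hα : α ∈ Ioo (0 : ℝ) 1) :
    0 < Real.cos (α * stripAngle α) := by
  have h0 := Real.pi_pos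
  refine Real.cos_pos_of_mem_Ioo ⟨by nlinarith [stripAngle_pos hα, hα.1], ?_⟩
  have h1 : (0 : ℝ) < 1 + α := by linarith [hα.1]
  rw [stripAngle, mul_div_assoc', div_lt_div_iff₀ h1 two_pos]
  nlinarith [hα.2]

/-- The bound grows without limit in `c`, which is the source of decay at every exponential rate. -/
theorem le_re_exp {α : ℝ} (hα : α ∈ Ioo (0 : ℝ) 1) {c v ψ : ℝ} (hv : c ≤ v)
    (hψ : |ψ| ≤ stripAngle α) : Real.exp (α * c) * Real.cos (α * stripAngle α) ≤
      (Complex.exp (α * (v + ψ * Complex.I))).re := by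
  have h : (α * (v + ψ * Complex.I) : ℂ).re = α * v ∧ (α * (v + ψ * Complex.I) : ℂ).im = α * ψ := by
    simp
  rw [Complex.exp_re, h.1, h.2]
  have hpi : α * stripAngle α ≤ Real.pi := by nlinarith [(stripAngle_mem hα).2, stripAngle_pos hα,
    hα.1, hα.2]
  have hcos : Real.cos (α * stripAngle α) ≤ Real.cos (α * ψ) := by
    rw [← Real.cos_abs (α * ψ), abs_mul, abs_of_pos hα.1]
    exact Real.cos_le_cos_of_nonneg_of_le_pi (mul_nonneg hα.1.le (abs_nonneg _)) hpi
      (mul_le_mul_of_nonneg_left hψ hα.1.le)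
  exact mul_le_mul (Real.exp_le_exp.2 (mul_le_mul_of_nonneg_left hv hα.1.le)) hcos
    (cos_mul_stripAngle_pos hα).le (Real.exp_pos _).le

/-- The part of the contour integral on a horizontal ray. -/
theorem isLaplaceMix_ray {α : ℝ} (hα : α ∈ Ioo (0 : ℝ) 1) (c : ℝ) {ψ : ℝ}
    (hψ : |ψ| = stripAngle α) : IsLaplaceMix (volume.restrict (Ioi c))
      (fun v => hankelFun α 0 α (v + ψ * Complex.I))
      (fun v => Complex.exp (α * (v + ψ * Complex.I)))
      (Real.exp (α * c) * Real.cos (α * stripAngle α)) where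
  integrable := integrableOn_ray_hankelFun hα.2 (stripAngle_mem' hα) _ _
    (by rw [hψ]; exact ⟨le_rfl, (stripAngle_mem hα).2.le⟩) c
  continuous := by fun_prop
  le_re := (ae_restrict_iff' measurableSet_Ioi).2
    (ae_of_all _ fun _ hv => le_re_exp hα (le_of_lt hv) hψ.le)

/-- The part of the contour integral on a vertical segment. -/
theorem isLaplaceMix_segment {α : ℝ} (hα : α ∈ Ioo (0 : ℝ) 1) (c : ℝ) :
    IsLaplaceMix (volume.restrict (Ioc (-stripAngle α) (stripAngle α)))
      (fun θ => hankelFun α 0 α (c + θ * Complex.I) * Complex.I)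
      (fun θ => Complex.exp (α * (c + θ * Complex.I)))
      (Real.exp (α * c) * Real.cos (α * stripAngle α)) where
  integrable := by
    have hcont : Continuous fun θ : ℝ => hankelFun α 0 α (c + θ * Complex.I) * Complex.I :=
      ((differentiable_hankelFun α 0 α).continuous.comp (by fun_prop)).mul continuous_const
    exact hcont.integrableOn_Icc.mono_set Ioc_subset_Icc_self
  continuous := by fun_prop
  le_re := (ae_restrict_iff' measurableSet_Ioc).2
    (ae_of_all _ fun _ hθ => le_re_exp hα le_rfl (abs_le.2 ⟨hθ.1.le, hθ.2⟩))

/-- The abscissa `c` of the vertical segment is free, as the integral does not depend on the path.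
-/
theorem HasStripIntegral.eq_laplaceMix {α : ℝ} (hα : α ∈ Ioo (0 : ℝ) 1) {x : ℝ} {J : ℂ}
    (h : HasStripIntegral (stripAngle α) (hankelFun α x α) J) (c : ℝ) :
    J = laplaceMix (volume.restrict (Ioi c))
        (fun v => hankelFun α 0 α (v + stripAngle α * Complex.I))
        (fun v => Complex.exp (α * (v + stripAngle α * Complex.I))) x -
      laplaceMix (volume.restrict (Ioi c))
        (fun v => hankelFun α 0 α (v + (-stripAngle α : ℝ) * Complex.I))
        (fun v => Complex.exp (α * (v + (-stripAngle α : ℝ) * Complex.I))) x +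
      laplaceMix (volume.restrict (Ioc (-stripAngle α) (stripAngle α)))
        (fun θ => hankelFun α 0 α (c + θ * Complex.I) * Complex.I)
        (fun θ => Complex.exp (α * (c + θ * Complex.I))) x := by
  have hpos := stripAngle_pos hα
  have hmem : |stripAngle α| ∈ Icc (stripAngle α) Real.pi := by
    rw [abs_of_pos hpos]; exact ⟨le_rfl, (stripAngle_mem hα).2.le⟩
  rw [h.eq_rays (differentiable_hankelFun _ _ _).continuous ⟨le_rfl, (stripAngle_mem hα).2.le⟩ c
    (integrableOn_ray_hankelFun hα.2 (stripAngle_mem' hα) _ _ hmem c)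
    (integrableOn_ray_hankelFun hα.2 (stripAngle_mem' hα) _ _ (by rwa [abs_neg]) c),
    intervalIntegral.integral_of_le (by linarith)]
  simp only [hankelFun_eq_mul_exp α x α]
  simp only [laplaceMix, mul_right_comm _ Complex.I]

theorem eq_sum_of_hasStripIntegral_moment {α : ℝ} (hα : α ∈ Ioo (0 : ℝ) 1) {r : ℕ} {J : ℂ}
    (h : HasStripIntegral (stripAngle α) (hankelFun α 0 (α - (r + 1) * α)) J) (c : ℝ) :
    J = (∫ v in Ioi c, hankelFun α 0 α (v + stripAngle α * Complex.I) /
          Complex.exp (α * (v + stripAngle α * Complex.I)) ^ (r + 1)) -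
      (∫ v in Ioi c, hankelFun α 0 α (v + (-stripAngle α : ℝ) * Complex.I) /
          Complex.exp (α * (v + (-stripAngle α : ℝ) * Complex.I)) ^ (r + 1)) +
      ∫ θ in Ioc (-stripAngle α) (stripAngle α), hankelFun α 0 α (c + θ * Complex.I) * Complex.I /
          Complex.exp (α * (c + θ * Complex.I)) ^ (r + 1) := by
  have hpos := stripAngle_pos hα
  have hmem : |stripAngle α| ∈ Icc (stripAngle α) Real.pi := by
    rw [abs_of_pos hpos]; exact ⟨le_rfl, (stripAngle_mem hα).2.le⟩
  rw [h.eq_rays (differentiable_hankelFun _ _ _).continuous ⟨le_rfl, (stripAngle_mem hα).2.le⟩ c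
    (integrableOn_ray_hankelFun hα.2 (stripAngle_mem' hα) _ _ hmem c)
    (integrableOn_ray_hankelFun hα.2 (stripAngle_mem' hα) _ _ (by rwa [abs_neg]) c),
    intervalIntegral.integral_of_le (by linarith)]
  simp only [mul_div_right_comm _ Complex.I, hankelFun_div_pow]

theorem hankelFun_zero_left (α β : ℝ) : hankelFun α 0 β = hankelFun 0 0 β := by
  funext w
  simp [hankelFun]

/-- The density of the Mittag-Leffler distribution. -/
theorem exists_superexpDecay_mittagLeffler {α : ℝ} (hα : α ∈ Ioo (0 : ℝ) 1) :
    ∃ g : ℝ → ℝ, SuperexpDecay g ∧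
      (∀ r : ℕ, ∫ x in Ioi (0 : ℝ), x ^ r * g x = r.factorial / Real.Gamma (r * α + 1)) ∧
      ∀ x, 0 < x → HasStripIntegral (stripAngle α) (hankelFun α x α)
        (2 * Real.pi * Complex.I * g x) := by
  choose J hJ using fun x : ℝ =>
    exists_hasStripIntegral_hankelFun hα.2 (stripAngle_mem' hα) x α
  have hpi := Real.pi_pos
  have hpi0 : (Real.pi : ℂ) ≠ 0 := Complex.ofReal_ne_zero.2 hpi.ne'
  -- `J x` is purely imaginary by conjugation symmetry, so nothing is lost in taking its imaginary
  -- part; extension by 0 makes `g` measurable on the whole line.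
  set g : ℝ → ℝ := (Ioi (0 : ℝ)).indicator fun x => (J x).im / (2 * Real.pi) with hg
  have hgx : ∀ x, 0 < x → g x = (J x).im / (2 * Real.pi) := fun x hx => indicator_of_mem hx _
  have hgJ : ∀ x, 0 < x → 2 * Real.pi * Complex.I * g x = J x := fun x hx => by
    have h1 := (hJ x).neg_conj_eq (stripAngle_mem hα).2.le (hankelFun_conj α x α)
    have h2 : (J x).re = 0 := by
      have := congrArg Complex.re h1
      simp at this
      linarith
    rw [hgx x hx]
    push_cast
    field_simp
    apply Complex.ext <;> simp [h2]
  have hmix := fun x c => (hJ x).eq_laplaceMix hα c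
  have habs := abs_of_pos (stripAngle_pos hα)
  have hmix1 := fun c => isLaplaceMix_ray hα c habs
  have hmix2 := fun c => isLaplaceMix_ray hα c ((abs_neg _).trans habs)
  have hmix3 := fun c => isLaplaceMix_segment hα c
  have hκ := fun c : ℝ => mul_pos (Real.exp_pos (α * c)) (cos_mul_stripAngle_pos hα)
  have hcont : ContinuousOn g (Ioi 0) := by
    have hJc : ContinuousOn J (Ioi 0) :=
      ((((hmix1 0).continuousOn (hκ 0)).sub ((hmix2 0).continuousOn (hκ 0))).add
        ((hmix3 0).continuousOn (hκ 0))).congr fun x _ => hmix x 0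
    exact ((Complex.continuous_im.comp_continuousOn hJc).div_const _).congr hgx
  have hdecay : SuperexpDecay g := by
    refine ⟨?_, hcont, fun K => ?_⟩
    · have : g = (Ioi (0 : ℝ)).piecewise g (fun _ => 0) := by
        funext x
        by_cases hx : x ∈ Ioi (0 : ℝ)
        · simp [hx]
        · simp [hg, hx]
      rw [this]
      exact hcont.measurable_piecewise continuousOn_const measurableSet_Ioi
    · obtain ⟨c, hc⟩ : ∃ c : ℝ, K ≤ Real.exp (α * c) * Real.cos (α * stripAngle α) := by
        have h1 : Tendsto (fun c : ℝ => Real.exp (α * c) * Real.cos (α * stripAngle α)) atTop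
            atTop := (Real.tendsto_exp_atTop.comp
              (tendsto_id.const_mul_atTop hα.1)).atTop_mul_const (cos_mul_stripAngle_pos hα)
        exact (h1.eventually (eventually_ge_atTop K)).exists
      obtain ⟨B₁, hB₁, h₁⟩ := (hmix1 c).exists_norm_le
      obtain ⟨B₂, hB₂, h₂⟩ := (hmix2 c).exists_norm_le
      obtain ⟨B₃, hB₃, h₃⟩ := (hmix3 c).exists_norm_le
      refine ⟨(B₁ + B₂ + B₃) / (2 * Real.pi), fun x hx => ?_⟩
      rw [hgx x hx, abs_div, abs_of_pos (by positivity : 0 < 2 * Real.pi), div_mul_eq_mul_div]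
      refine div_le_div_of_nonneg_right ?_ (by positivity)
      refine (Complex.abs_im_le_norm _).trans ?_
      rw [hmix x c]
      refine (norm_add_le_of_le (norm_sub_le_of_le (h₁ x hx.le) (h₂ x hx.le)) (h₃ x hx.le)).trans ?_
      rw [← mul_add, ← mul_add, mul_comm]
      refine mul_le_mul_of_nonneg_left (Real.exp_le_exp.2 ?_) (by positivity)
      nlinarith
  refine ⟨g, hdecay, fun r => ?_, fun x hx => by rw [hgJ x hx]; exact hJ x⟩
  have hpos : (0 : ℝ) < r * α + 1 := by
    have := mul_nonneg r.cast_nonneg hα.1.le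
    linarith
  obtain ⟨M, hM⟩ := exists_hasStripIntegral_hankelFun hα.2 (stripAngle_mem' hα) 0
    (α - (r + 1) * α)
  have hMeq := eq_sum_of_hasStripIntegral_moment hα hM 0
  -- Here α - (r+1)α = 1 - (rα+1), so Hankel's formula applies with z = rα + 1.
  have hMG : M = 2 * Real.pi * Complex.I / Real.Gamma (r * α + 1) := by
    refine HasStripIntegral.gamma (stripAngle_mem' hα) hpos ?_
    rw [hankelFun_zero_left] at hM
    convert hM using 2
    ring
  have h1 : ∫ x in Ioi (0 : ℝ), (x : ℂ) ^ r * J x = r.factorial * M := by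
    simp only [hmix _ 0, mul_add (Complex.ofReal _ ^ r), mul_sub (Complex.ofReal _ ^ r)]
    rw [integral_add (((hmix1 0).integrableOn_pow_mul (hκ 0) r).fun_sub
        ((hmix2 0).integrableOn_pow_mul (hκ 0) r)) ((hmix3 0).integrableOn_pow_mul (hκ 0) r),
      integral_sub ((hmix1 0).integrableOn_pow_mul (hκ 0) r)
        ((hmix2 0).integrableOn_pow_mul (hκ 0) r),
      (hmix1 0).integral_pow_mul (hκ 0), (hmix2 0).integral_pow_mul (hκ 0),
      (hmix3 0).integral_pow_mul (hκ 0), hMeq]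
    ring
  have h2 : ∫ x in Ioi (0 : ℝ), (x : ℂ) ^ r * J x =
      2 * Real.pi * Complex.I * (∫ x in Ioi (0 : ℝ), x ^ r * g x : ℝ) := by
    rw [← integral_complex_ofReal, ← integral_const_mul]
    refine setIntegral_congr_fun measurableSet_Ioi fun x hx => ?_
    simp only [← hgJ x hx]
    push_cast
    ring
  rw [h1, hMG] at h2
  have h3 : (2 * Real.pi * Complex.I : ℂ) ≠ 0 := by simp [hpi0]
  apply Complex.ofReal_injective
  refine mul_left_cancel₀ h3 ?_
  rw [← h2]
  push_cast
  ring

/-- With w = log(-t) one has (-t)^{-p} = -e^{(1-p)w}/t, which accounts for the exponent β = 1 - p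
and the sign. -/
theorem densityIntegrand_eq (p x : ℝ) {t : ℂ} (ht : -t ∈ Complex.slitPlane) :
    densityIntegrand p x t =
      -hankelFun (1 - p) x (1 - p) (Complex.log (-t)) / t := by
  have h0 : -t ≠ 0 := Complex.slitPlane_ne_zero ht
  have h1 := Complex.exp_log h0
  rw [densityIntegrand, Complex.cpow_def_of_ne_zero h0, Complex.cpow_def_of_ne_zero h0, hankelFun,
    h1, neg_div, ← div_neg]
  generalize Complex.log (-t) = w at h1 ⊢
  rw [← h1, ← Complex.exp_sub, ← Complex.exp_sub]
  congr 1
  push_cast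
  ring_nf

theorem hankelIntegral_densityIntegrand {p x δ : ℝ} (hp : p ∈ Ioo (0 : ℝ) 1) (hδ : 0 < δ) {J : ℂ}
    (h : HasStripIntegral (stripAngle (1 - p)) (hankelFun (1 - p) x (1 - p)) J) :
    HankelIntegrable δ (densityIntegrand p x) ∧ hankelIntegral δ (densityIntegrand p x) = J := by
  have hα : 1 - p ∈ Ioo (0 : ℝ) 1 := ⟨by linarith [hp.2], by linarith [hp.1]⟩
  obtain ⟨C, hC⟩ := exists_bound_hankelFun hα.2 (stripAngle_mem' hα) x (1 - p)
  exact h.hankel (differentiable_hankelFun _ _ _).continuous (stripAngle_pos hα).le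
    (stripAngle_mem hα).2 hC (fun t ht => densityIntegrand_eq p x ht) hδ

/-! ### Convergence of the rescaled path length -/

/-- The law of the rescaled path length. -/
noncomputable def scaledPathLength (p : ℝ) (hp : p ∈ Ioo (0 : ℝ) 1) (n : ℕ) :
    ProbabilityMeasure ℝ :=
  ⟨(pathLength p hp n).toMeasure.map fun k : ℕ => (k : ℝ) / (n : ℝ) ^ (1 - p),
    Measure.isProbabilityMeasure_map (measurable_of_countable _).aemeasurable⟩

theorem mainTheorem2 (p : ℝ) (hp : p ∈ Ioo (0 : ℝ) 1) :
    (∀ n m : ℕ, 1 ≤ m → m ≤ n →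
      (pathLength p hp n m).toReal =
        ∑ j ∈ Finset.range m, ((m - 1).choose j : ℝ) * (-1) ^ (n + j - 1) *
          Ring.choose ((j : ℝ) - p * (j + 1)) (n - 1)) ∧
    ∃ L : ProbabilityMeasure ℝ,
      TendstoInDistribution (fun (n : ℕ) (k : ℕ) => (k : ℝ) / (n : ℝ) ^ (1 - p)) atTop
        (id : ℝ → ℝ) (fun n => (pathLength p hp n).toMeasure) (L : Measure ℝ) ∧
      IsMittagLeffler (1 - p) L ∧
      (∀ L' : ProbabilityMeasure ℝ, IsMittagLeffler (1 - p) L' → L' = L) ∧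
      ∃ g : ℝ → ℝ,
        (∀ x : ℝ, 0 < x → 0 ≤ g x) ∧
        (∀ x : ℝ, 0 < x → ∀ δ : ℝ, 0 < δ →
          HankelIntegrable δ (densityIntegrand p x) ∧
          (g x : ℂ) = 1 / (2 * Real.pi * Complex.I) * hankelIntegral δ (densityIntegrand p x)) ∧
        (L : Measure ℝ) =
          (volume.restrict (Ioi 0)).withDensity (fun x => ENNReal.ofReal (g x)) := by
  refine ⟨toReal_pathLength_eq p hp, ?_⟩
  have hα : 1 - p ∈ Ioo (0 : ℝ) 1 := ⟨by linarith [hp.2], by linarith [hp.1]⟩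
  obtain ⟨g, hg, hmom, hstrip⟩ := exists_superexpDecay_mittagLeffler hα
  have hmeas : ∀ n : ℕ, Measurable fun k : ℕ => (k : ℝ) / (n : ℝ) ^ (1 - p) := fun n =>
    measurable_of_countable _
  -- Nonnegativity of `g` is an outcome of this step: it is inherited from the laws of the path
  -- lengths, not read off the contour integral.
  obtain ⟨hg0, L, hlim, hdens, hLmom, huniq⟩ := hg.method_of_moments
    (μ := scaledPathLength p hp)
    (fun n r => (integrable_map_measure (continuous_pow r).aestronglyMeasurable (hmeas n).aemeasurable).2
      (integrable_toMeasure_pathLength p hp n _))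
    (fun r => by
      rw [hmom r]
      refine (tendsto_moment_pathLength p hp r).congr fun n => ?_
      exact (integral_map (hmeas n).aemeasurable (continuous_pow r).aestronglyMeasurable).symm)
  refine ⟨L, ⟨fun n => (hmeas n).aemeasurable, aemeasurable_id, ?_⟩, fun r => ?_, fun L' hL' => ?_,
    g, hg0, fun x hx δ hδ => ?_, hdens⟩
  · simp only [Measure.map_id]
    exact hlim
  · exact ⟨(hLmom r).1, (hLmom r).2.trans (hmom r)⟩
  · exact huniq L' fun r => ⟨(hL' r).1, (hL' r).2.trans (hmom r).symm⟩
  · obtain ⟨h1, h2⟩ := hankelIntegral_densityIntegrand hp hδ (hstrip x hx)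
    refine ⟨h1, ?_⟩
    have h3 : (2 * Real.pi * Complex.I : ℂ) ≠ 0 := by
      simp [Real.pi_ne_zero]
    rw [h2, ← mul_assoc, one_div_mul_cancel h3, one_mul]
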